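/- Let $\mathcal A$ be a finite dimensional Hopf algebra over a field $k$ with counit $\epsilon$ and invertible antipode $S$. Write $\Delta(y)=y'\otimes y''$, etc. Let $\mathcal A^o$ be the dual Hopf algebra with opposite comultiplication: $\langle\lambda\nu,a\rangle=\langle\lambda\otimes\nu,\Delta(a)\rangle$, $\langle\Delta(\lambda),a\otimes b\rangle=\langle\lambda,ba\rangle$, $\langle S(\lambda),a\rangle=\langle\lambda,S^{-1}(a)\rangle$. Let $D(\mathcal A)$ be the quantum double: the Hopf algebra which contains $\mathcal A$ and $\mathcal A^o$ as sub-Hopf algebras, for which the multiplication $\lambda\otimes y\mapsto\lambda\cdot y$ is a linear isomorphism $\mathcal A^o\otimes\mathcal A\to D(\mathcal A)$, and in which $$y\cdot\lambda=\langle\lambda',y'\rangle\,\langle S(\lambda'''),y'''\rangle\;\lambda''\cdot y''\qquad(y\in\mathcal A,\ \lambda\in\mathcal A^o).$$ For a finite dimensional Hopf algebra $H$, a linear form $\mu$ on $H$ is a left (right) integral if $(1\otimes\mu)\Delta(h)=\mu(h)1$ (respectively $(\mu\otimes 1)\Delta(h)=\mu(h)1$) for all $h\in H$, and $x\in H$ is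 a left cointegral if $hx=\epsilon(h)x$ for all $h$. The modulus belonging to a left cointegral $x\neq0$ is the one dimensional representation $\alpha$ of $H$ with $xh=\alpha(h)x$ for all $h$; the comodulus belonging to a left integral $\mu\ne0$ is the group like element $a\in H$ with $(\mu\otimes1)\Delta(h)=\mu(h)a$ for all $h$. A $q$-character of $H$ is a linear form $\chi$ with $\chi(yz)=\chi(S^2(z)y)$ for all $y,z\in H$. Let $\mu$ be a left integral and $x$ a left cointegral of $\mathcal A$ with $\mu(x)=1$, let $\alpha$ and $a$ be the corresponding modulus and comodulus, and put $\omega=\alpha(a)$. Let $(e_i)$ be a basis of $\mathcal A$ with dual basis $(f_i)$ of $\mathcal A^o$, and put in $D(\mathcal A)$ $$p=\mu\cdot S^{-1}(x),\qquad u=\sum_iS(f_i)\,e_i,\qquad \hat u=\sum_iS^2(e_i)\,f_i,\qquad g=u\,\hat u .$$ Define a linear form $\mu_D$ on $D(\mathcal A)$ by $\mu_D(\lambda\cdot y)=\lambda(x)\,\mu(S(y))$ for $\lambda\in\mathcal A^o$, $y\in\mathcal A$. Then: 1. $\mu_D$ is a right integral of $D(\mathcal A)$, and $\mu_D(p)=1$.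 2. $g$ is invertible, $D(\mathcal A)$ has a nonzero left integral, and for every nonzero left integral of $D(\mathcal A)$ the comodulus $a_D$ exists and equals $g^{-1}$. 3. $\mu_D$ is a $q$-character of $D(\mathcal A)$, and $\mu_D(\lambda\cdot y)=\omega\,\mu_D(y\cdot\lambda)$ for all $y\in\mathcal A$, $\lambda\in\mathcal A^o$. -/

import Mathlib

set_option linter.unusedSectionVars false

noncomputable section

open scoped TensorProduct

namespace HopfDouble
open Coalgebra HopfAlgebra

section Antipode
variable (k A : Type*) [Field k] [Ring A] [HopfAlgebra k A]

/-- The antipode of the Hopf algebra `A` is invertible. -/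
class InvertibleAntipode : Prop where
  bijective : Function.Bijective (antipode k (A := A))

variable [InvertibleAntipode k A]

/-- The inverse `S⁻¹` of the antipode. -/
def antipodeInv : A →ₗ[k] A :=
  (LinearEquiv.ofBijective (antipode k (A := A)) InvertibleAntipode.bijective).symm.toLinearMap

variable {A}

@[simp] theorem antipode_antipodeInv (a : A) : antipode k (antipodeInv k A a) = a :=
  (LinearEquiv.ofBijective (antipode k (A := A)) InvertibleAntipode.bijective).apply_symm_apply a

@[simp] theorem antipodeInv_antipode (a : A) : antipodeInv k A (antipode k a) = a :=
  (LinearEquiv.ofBijective (antipode k (A := A)) InvertibleAntipode.bijective).symm_apply_apply a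

theorem antipode_inj {a b : A} (h : antipode k a = antipode k b) : a = b :=
  (InvertibleAntipode.bijective (k := k) (A := A)).1 h

theorem antipodeInv_mul (a b : A) :
    antipodeInv k A (a * b) = antipodeInv k A b * antipodeInv k A a :=
  antipode_inj k (by simp [antipode_mul_antidistrib])

@[simp] theorem antipodeInv_one : antipodeInv k A (1 : A) = 1 :=
  antipode_inj k (by simp)

@[simp] theorem counit_antipodeInv (a : A) : counit (R := k) (antipodeInv k A a) = counit a := by
  rw [← counit_antipode (R := k) (antipodeInv k A a), antipode_antipodeInv]

theorem mul_antipodeInv (a : A) :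
    LinearMap.mul' k A (TensorProduct.map .id (antipodeInv k A)
      (TensorProduct.comm k A A (comul a))) = algebraMap k A (counit a) := by
  apply antipode_inj k
  have h := sum_mul_antipode_eq_algebraMap_counit (R := k) (ℛ k a)
  rw [← (ℛ k a).eq]
  simp only [map_sum, TensorProduct.comm_tmul, TensorProduct.map_tmul, LinearMap.mul'_apply,
    LinearMap.id_apply, antipode_mul_antidistrib, antipode_antipodeInv, h]
  simp [Algebra.algebraMap_eq_smul_one]

theorem antipodeInv_mul' (a : A) :
    LinearMap.mul' k A (TensorProduct.map (antipodeInv k A) .id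
      (TensorProduct.comm k A A (comul a))) = algebraMap k A (counit a) := by
  apply antipode_inj k
  have h := sum_antipode_mul_eq_algebraMap_counit (R := k) (ℛ k a)
  rw [← (ℛ k a).eq]
  simp only [map_sum, TensorProduct.comm_tmul, TensorProduct.map_tmul, LinearMap.mul'_apply,
    LinearMap.id_apply, antipode_mul_antidistrib, antipode_antipodeInv, h]
  simp [Algebra.algebraMap_eq_smul_one]

end Antipode
section Comul
open CoassocSimps
variable {k A : Type*} [Field k] [Ring A] [HopfAlgebra k A]

theorem comul_antipode : comul ∘ₗ antipode k (A := A) =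
    TensorProduct.map (antipode k) (antipode k) ∘ₗ (TensorProduct.comm k A A).toLinearMap ∘ₗ comul := by
  apply WithConv.toConv_injective
  refine (left_inv_eq_right_inv ?_ LinearMap.comul_right_inv).symm
  apply WithConv.ext
  simp only [LinearMap.convMul_def, LinearMap.convOne_def, WithConv.ofConv_toConv]
  let S : A →ₗ[k] A := antipode k
  let e := LinearMap.lTensor A (TensorProduct.assoc k A A A).symm.toLinearMap ∘ₗ
    (TensorProduct.assoc k A A (A ⊗[k] A)).toLinearMap
  have h1 : e ∘ₗ TensorProduct.map comul comul ∘ₗ comul =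
      LinearMap.lTensor A (LinearMap.rTensor A comul) ∘ₗ LinearMap.lTensor A comul ∘ₗ
        comul (R := k) (A := A) := by
    simp only [e, coassoc_simps]
  let Ψ : A ⊗[k] ((A ⊗[k] A) ⊗[k] A) →ₗ[k] A ⊗[k] A :=
    TensorProduct.map (LinearMap.mul' k A ∘ₗ LinearMap.rTensor A S)
      (LinearMap.mul' k A ∘ₗ LinearMap.rTensor A S) ∘ₗ (TensorProduct.leftComm k A (A ⊗[k] A) A).toLinearMap
  have h2 : LinearMap.mul' k (A ⊗[k] A) ∘ₗ
      TensorProduct.map (TensorProduct.map S S ∘ₗ (TensorProduct.comm k A A).toLinearMap) .id = Ψ ∘ₗ e := by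
    ext p q r s
    simp [Ψ, e]
  have h3 : Ψ ∘ₗ LinearMap.lTensor A (LinearMap.rTensor A (comul (R := k))) ∘ₗ LinearMap.lTensor A comul =
      LinearMap.lTensor A (LinearMap.mul' k A ∘ₗ LinearMap.rTensor A S) ∘ₗ TensorProduct.mk k A _ 1 := by
    ext p q
    have : (Ψ ∘ₗ (TensorProduct.mk k A ((A ⊗[k] A) ⊗[k] A)) p ∘ₗ LinearMap.rTensor A comul) =
      TensorProduct.mk k A A 1 ∘ₗ LinearMap.mulLeft k (S p) ∘ₗ (TensorProduct.lid k A).toLinearMap ∘ₗ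
        LinearMap.rTensor A counit := by
      ext x y
      have := mul_antipode_rTensor_comul_apply (R := k) x
      simp only [TensorProduct.AlgebraTensorModule.curry_apply, LinearMap.restrictScalars_self,
        TensorProduct.curry_apply, LinearMap.comp_apply, LinearMap.rTensor_tmul,
        TensorProduct.mk_apply, Ψ, LinearEquiv.coe_coe, TensorProduct.leftComm_tmul,
        TensorProduct.map_tmul, S, this]
      simp [Algebra.algebraMap_eq_smul_one, TensorProduct.smul_tmul]
    have h := LinearMap.congr_fun this (comul q)
    simp only [LinearMap.comp_apply, rTensor_counit_comul] at h
    simpa using h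
  have h4 : LinearMap.mul' k (A ⊗[k] A) ∘ₗ TensorProduct.map (TensorProduct.map S S ∘ₗ
      (TensorProduct.comm k A A).toLinearMap ∘ₗ comul) comul = LinearMap.mul' k (A ⊗[k] A) ∘ₗ
      TensorProduct.map (TensorProduct.map S S ∘ₗ (TensorProduct.comm k A A).toLinearMap) .id ∘ₗ
      TensorProduct.map comul comul := by
    rw [← TensorProduct.map_comp]; rfl
  ext a
  have h5 := LinearMap.congr_fun h4 (comul a)
  have h6 := LinearMap.congr_fun h2 (TensorProduct.map comul comul (comul (R := k) a))
  have h7 := LinearMap.congr_fun h1 a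
  have h8 := LinearMap.congr_fun h3 (comul a)
  have h9 := mul_antipode_rTensor_comul_apply (R := k) a
  simp only [LinearMap.comp_apply] at h5 h6 h7 h8
  rw [h7, h8] at h6
  simp only [LinearMap.comp_apply]
  refine (h5.trans h6).trans ?_
  simp only [TensorProduct.mk_apply, LinearMap.lTensor_tmul, LinearMap.comp_apply, S, h9]
  simp [Algebra.algebraMap_eq_smul_one, Algebra.TensorProduct.one_def]

theorem comul_antipodeInv [InvertibleAntipode k A] (a : A) : comul (R := k) (antipodeInv k A a) =
    TensorProduct.map (antipodeInv k A) (antipodeInv k A) (TensorProduct.comm k A A (comul a)) := by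
  have h := LinearMap.congr_fun (comul_antipode (k := k)) (antipodeInv k A a)
  simp only [LinearMap.comp_apply, antipode_antipodeInv] at h
  rw [h]
  generalize comul (R := k) (antipodeInv k A a) = t
  induction t with
  | zero => simp
  | add x y hx hy => rw [map_add, map_add, map_add, map_add, ← hx, ← hy]
  | tmul x y => simp
end Comul

section Dual
variable (k A : Type*) [Field k] [Ring A] [HopfAlgebra k A]

/-- The dual space of `A`, as an algebra under convolution `⟨lm, a⟩ = ⟨l ⊗ m, Δ(a)⟩`. -/
def CopDual : Type _ := WithConv (A →ₗ[k] k)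

instance : Ring (CopDual k A) := inferInstanceAs (Ring (WithConv (A →ₗ[k] k)))
instance : Algebra k (CopDual k A) := inferInstanceAs (Algebra k (WithConv (A →ₗ[k] k)))

variable {k A}

/-- The contraction `⟨l, a⟩`, regarding an element of `A°` as a linear form. -/
def toDual : CopDual k A ≃ₗ[k] Module.Dual k A := WithConv.linearEquiv k (A →ₗ[k] k)

theorem toDual_mul (l m : CopDual k A) (a : A) : toDual (l * m) a =
    LinearMap.mul' k k (TensorProduct.map (toDual l) (toDual m) (comul a)) := rfl

@[simp] theorem toDual_one (a : A) : toDual (1 : CopDual k A) a = counit a := rfl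

theorem CopDual.ext {l m : CopDual k A} (h : ∀ a, toDual l a = toDual m a) : l = m :=
  toDual.injective (LinearMap.ext h)

variable [FiniteDimensional k A]

/-- The contraction `⟨l ⊗ m, a ⊗ b⟩ = ⟨l, a⟩ ⟨m, b⟩`. -/
def toDual₂ : CopDual k A ⊗[k] CopDual k A ≃ₗ[k] Module.Dual k (A ⊗[k] A) :=
  (TensorProduct.congr toDual toDual).trans (TensorProduct.dualDistribEquiv k A A)

@[simp] theorem toDual₂_tmul (l m : CopDual k A) (a b : A) :
    toDual₂ (l ⊗ₜ m) (a ⊗ₜ b) = toDual l a * toDual m b := by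
  simp [toDual₂, TensorProduct.dualDistribEquiv, TensorProduct.dualDistribEquivOfBasis]

instance : CoalgebraStruct k (CopDual k A) where
  comul := toDual₂.symm.toLinearMap ∘ₗ
    (LinearMap.mul' k A ∘ₗ (TensorProduct.comm k A A).toLinearMap).dualMap ∘ₗ toDual.toLinearMap
  counit := LinearMap.applyₗ (1 : A) ∘ₗ toDual.toLinearMap

/-- The comultiplication of `A°` is `⟨Δ(l), a ⊗ b⟩ = ⟨l, ba⟩`. -/
theorem toDual₂_comul (l : CopDual k A) : toDual₂ (comul (R := k) l) =
    toDual l ∘ₗ LinearMap.mul' k A ∘ₗ (TensorProduct.comm k A A).toLinearMap :=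
  toDual₂.apply_symm_apply _

theorem toDual₂_comul_tmul (l : CopDual k A) (a b : A) :
    toDual₂ (comul (R := k) l) (a ⊗ₜ b) = toDual l (b * a) := by
  simp [toDual₂_comul]

@[simp] theorem counit_copDual (l : CopDual k A) : counit (R := k) l = toDual l 1 := rfl

section contract
variable {M : Type*} [AddCommGroup M] [Module k M]
/-- Contraction of the first tensor factor with `a`. -/
def contract (a : A) : CopDual k A ⊗[k] M →ₗ[k] M :=
  (TensorProduct.lid k M).toLinearMap ∘ₗ LinearMap.rTensor M (LinearMap.applyₗ a ∘ₗ toDual.toLinearMap)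

@[simp] theorem contract_tmul (a : A) (l : CopDual k A) (m : M) :
    contract a (l ⊗ₜ[k] m) = toDual l a • m := by simp [contract]

theorem contract_ext {s t : CopDual k A ⊗[k] M} (h : ∀ a, contract a s = contract a t) : s = t := by
  have h1 : ∀ (s : CopDual k A ⊗[k] M) (a : A), dualTensorHomEquiv k A M
      (LinearEquiv.rTensor M (toDual (k := k) (A := A)) s) a = contract a s := by
    intro s a
    induction s with
    | zero => simp
    | add x y hx hy => simp only [map_add, LinearMap.add_apply, hx, hy]
    | tmul x y => simp
  apply (LinearEquiv.rTensor M (toDual (k := k) (A := A))).injective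
  apply (dualTensorHomEquiv k A M).injective
  ext a
  rw [h1, h1, h a]

theorem toDual_contract (a b : A) (t : CopDual k A ⊗[k] CopDual k A) :
    toDual (contract a t) b = toDual₂ t (a ⊗ₜ b) := by
  induction t with
  | zero => simp
  | add x y hx hy => simp [hx, hy]
  | tmul x y => simp
end contract

instance : Coalgebra k (CopDual k A) where
  coassoc := by
    refine LinearMap.ext fun l => contract_ext fun a => contract_ext fun b => CopDual.ext fun c => ?_
    have h1 : ∀ t : CopDual k A ⊗[k] CopDual k A,
      contract b (contract a (TensorProduct.assoc k _ _ _ (LinearMap.rTensor _ comul t))) =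
        contract (b * a) t := by
      intro t
      have h0 : ∀ (s : CopDual k A ⊗[k] CopDual k A) (m : CopDual k A),
        contract b (contract a (TensorProduct.assoc k _ _ _ (s ⊗ₜ m))) = toDual₂ s (a ⊗ₜ b) • m := by
        intro s m
        induction s with
        | zero => simp
        | add x y hx hy => simp [hx, hy, TensorProduct.add_tmul, add_smul]
        | tmul x y => simp [smul_smul]
      induction t with
      | zero => simp
      | add x y hx hy => simp [hx, hy]
      | tmul x y => simp [h0, toDual₂_comul_tmul]
    have h2 : ∀ t : CopDual k A ⊗[k] CopDual k A,
      contract a (LinearMap.lTensor _ (comul (R := k)) t) = comul (R := k) (contract a t) := by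
      intro t
      induction t with
      | zero => simp
      | add x y hx hy => simp [hx, hy]
      | tmul x y => simp
    simp only [LinearMap.comp_apply, LinearEquiv.coe_coe, h1, h2, toDual_contract,
      toDual₂_comul_tmul, mul_assoc]
  rTensor_counit_comp_comul := by
    refine LinearMap.ext fun l => (TensorProduct.lid k _).injective (CopDual.ext fun c => ?_)
    have h : ∀ t : CopDual k A ⊗[k] CopDual k A,
      (TensorProduct.lid k _ (LinearMap.rTensor (CopDual k A) (counit (R := k)) t)) = contract 1 t := by
      intro t
      induction t with
      | zero => simp
      | add x y hx hy => simp [hx, hy]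
      | tmul x y => simp
    simp [h, toDual_contract, toDual₂_comul_tmul]
  lTensor_counit_comp_comul := by
    refine LinearMap.ext fun l => (TensorProduct.rid k _).injective (CopDual.ext fun c => ?_)
    have h : ∀ t : CopDual k A ⊗[k] CopDual k A,
      toDual (TensorProduct.rid k _ (LinearMap.lTensor (CopDual k A) (counit (R := k)) t)) c =
        toDual₂ t (c ⊗ₜ 1) := by
      intro t
      induction t with
      | zero => simp
      | add x y hx hy => simp [hx, hy]
      | tmul x y => simp [mul_comm]
    simp [h, toDual₂_comul_tmul]

theorem toDual₂_ext {s t : CopDual k A ⊗[k] CopDual k A}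
    (h : ∀ a b, toDual₂ s (a ⊗ₜ b) = toDual₂ t (a ⊗ₜ b)) : s = t :=
  toDual₂.injective (TensorProduct.ext' h)

theorem toDual_mul_repr (l m : CopDual k A) (a : A) : toDual (l * m) a =
    ∑ i ∈ (ℛ k a).index, toDual l ((ℛ k a).left i) * toDual m ((ℛ k a).right i) := by
  rw [toDual_mul, ← (ℛ k a).eq]
  simp

theorem toDual₂_mul (s t : CopDual k A ⊗[k] CopDual k A) (a b : A) :
    toDual₂ (s * t) (a ⊗ₜ b) = ∑ i ∈ (ℛ k a).index, ∑ j ∈ (ℛ k b).index,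
      toDual₂ s ((ℛ k a).left i ⊗ₜ (ℛ k b).left j) *
        toDual₂ t ((ℛ k a).right i ⊗ₜ (ℛ k b).right j) := by
  induction s with
  | zero => simp
  | add x y hx hy => simp [hx, hy, add_mul, Finset.sum_add_distrib]
  | tmul x y =>
    induction t with
    | zero => simp
    | add u v hu hv => simp only [mul_add, map_add, LinearMap.add_apply, hu, hv, Finset.sum_add_distrib]
    | tmul u v =>
      simp only [Algebra.TensorProduct.tmul_mul_tmul, toDual₂_tmul, toDual_mul_repr,
        Finset.sum_mul_sum]
      exact Finset.sum_congr rfl fun _ _ => Finset.sum_congr rfl fun _ _ => by ring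

instance : Bialgebra k (CopDual k A) :=
  Bialgebra.mk' k (CopDual k A) (by simp)
    (by intro l m; simp [toDual_mul, Algebra.TensorProduct.one_def])
    (toDual₂_ext fun a b => by
      rw [toDual₂_comul_tmul, Algebra.TensorProduct.one_def, toDual₂_tmul]; simp [mul_comm])
    (by
      intro l m
      refine toDual₂_ext fun a b => ?_
      rw [toDual₂_comul_tmul, toDual₂_mul, toDual_mul, Bialgebra.comul_mul]
      conv_lhs => rw [← (ℛ k a).eq, ← (ℛ k b).eq]
      simp only [Finset.sum_mul_sum, Algebra.TensorProduct.tmul_mul_tmul, map_sum,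
        TensorProduct.map_tmul, LinearMap.mul'_apply, toDual₂_comul_tmul]
      exact Finset.sum_comm)

variable [InvertibleAntipode k A]

theorem toDual_mul_map (f g : CopDual k A →ₗ[k] CopDual k A) (F G : A →ₗ[k] A)
    (hf : ∀ l a, toDual (f l) a = toDual l (F a)) (hg : ∀ l a, toDual (g l) a = toDual l (G a))
    (t : CopDual k A ⊗[k] CopDual k A) (a : A) :
    toDual (LinearMap.mul' k _ (TensorProduct.map f g t)) a =
      toDual₂ t (TensorProduct.map F G (comul a)) := by
  induction t with
  | zero => simp
  | add x y hx hy => simp [hx, hy]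
  | tmul x y =>
    rw [← (ℛ k a).eq]
    simp only [TensorProduct.map_tmul, LinearMap.mul'_apply, toDual_mul_repr, map_sum, toDual₂_tmul,
      hf, hg]

/-- The antipode of `A°` is `⟨S(l), a⟩ = ⟨l, S⁻¹(a)⟩`. -/
instance : HopfAlgebra k (CopDual k A) where
  antipode := toDual.symm.toLinearMap ∘ₗ (antipodeInv k A).dualMap ∘ₗ toDual.toLinearMap
  mul_antipode_rTensor_comul := by
    refine LinearMap.ext fun l => CopDual.ext fun a => ?_
    have h := toDual_mul_map (k := k) (A := A)
      (toDual.symm.toLinearMap ∘ₗ (antipodeInv k A).dualMap ∘ₗ toDual.toLinearMap) .id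
      (antipodeInv k A) .id (fun _ _ => by simp) (fun _ _ => rfl) (comul l) a
    have h1 := congr(toDual l $(mul_antipodeInv k a))
    simp only [LinearMap.comp_apply, LinearMap.rTensor]
    rw [h, toDual₂_comul]
    simp only [LinearMap.comp_apply, LinearEquiv.coe_coe, ← TensorProduct.map_comm, h1]
    simp [Algebra.algebraMap_eq_smul_one, mul_comm]
  mul_antipode_lTensor_comul := by
    refine LinearMap.ext fun l => CopDual.ext fun a => ?_
    have h := toDual_mul_map (k := k) (A := A) .id
      (toDual.symm.toLinearMap ∘ₗ (antipodeInv k A).dualMap ∘ₗ toDual.toLinearMap)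
      .id (antipodeInv k A) (fun _ _ => rfl) (fun _ _ => by simp) (comul l) a
    have h1 := congr(toDual l $(antipodeInv_mul' k a))
    simp only [LinearMap.comp_apply, LinearMap.lTensor]
    rw [h, toDual₂_comul]
    simp only [LinearMap.comp_apply, LinearEquiv.coe_coe, ← TensorProduct.map_comm, h1]
    simp [Algebra.algebraMap_eq_smul_one, mul_comm]

@[simp] theorem toDual_antipode (l : CopDual k A) (a : A) :
    toDual (antipode k l) a = toDual l (antipodeInv k A a) := rfl

end Dual

section Double
variable (k A : Type*) [Field k] [Ring A] [HopfAlgebra k A]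

/-- The underlying space `A° ⊗ A` of the double. -/
def Double : Type _ := CopDual k A ⊗[k] A

instance : AddCommGroup (Double k A) := inferInstanceAs (AddCommGroup (CopDual k A ⊗[k] A))
instance : Module k (Double k A) := inferInstanceAs (Module k (CopDual k A ⊗[k] A))

variable {k A}
variable [FiniteDimensional k A] [InvertibleAntipode k A]

/-- `⟨adj(a ⊗ b)(l), c⟩ = ⟨l, S⁻¹(b) c a⟩`, that is, in terms of the iterated comultiplication
of `A°`, `adj(a ⊗ b)(l) = ⟨l', a⟩ ⟨S(l'''), b⟩ l''`. -/
def adj : A ⊗[k] A →ₗ[k] Module.End k (CopDual k A) :=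
  TensorProduct.lift (LinearMap.mk₂ k
    (fun a b => toDual.symm.toLinearMap ∘ₗ
      (LinearMap.mulLeft k (antipodeInv k A b) ∘ₗ LinearMap.mulRight k a).dualMap ∘ₗ
        toDual.toLinearMap)
    (fun a a' b => LinearMap.ext fun l => CopDual.ext fun c => by simp [mul_add])
    (fun r a b => LinearMap.ext fun l => CopDual.ext fun c => by simp)
    (fun a b b' => LinearMap.ext fun l => CopDual.ext fun c => by simp [add_mul])
    (fun r a b => LinearMap.ext fun l => CopDual.ext fun c => by simp))

@[simp] theorem toDual_adj (a b c : A) (l : CopDual k A) :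
    toDual (adj (a ⊗ₜ b) l) c = toDual l (antipodeInv k A b * (c * a)) := by
  simp [adj]

/-- `act(a ⊗ b ⊗ c)(l ⊗ w) = adj(a ⊗ c)(l) ⊗ bw`. -/
def act : A ⊗[k] (A ⊗[k] A) →ₗ[k] Module.End k (CopDual k A ⊗[k] A) :=
  TensorProduct.homTensorHomMap (RingHom.id k) _ _ _ _ ∘ₗ TensorProduct.map adj (LinearMap.mul k A) ∘ₗ
    (TensorProduct.assoc k A A A).symm.toLinearMap ∘ₗ
      LinearMap.lTensor A (TensorProduct.comm k A A).toLinearMap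

@[simp] theorem act_tmul (a b c w : A) (l : CopDual k A) :
    act (a ⊗ₜ (b ⊗ₜ c)) (l ⊗ₜ w) = adj (a ⊗ₜ c) l ⊗ₜ (b * w) := by
  simp [act]

variable (k A) in
/-- The iterated comultiplication `a ↦ a' ⊗ a'' ⊗ a'''`. -/
def comul₃ : A →ₗ[k] A ⊗[k] (A ⊗[k] A) := LinearMap.lTensor A comul ∘ₗ comul

/-- Left multiplication by `y ∈ A`: `y (l ⊗ w) = adj(y' ⊗ y''')(l) ⊗ y''w`. -/
def rho : A →ₗ[k] Module.End k (CopDual k A ⊗[k] A) := act ∘ₗ comul₃ k A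

/-- Left multiplication by `l ∈ A°`. -/
def lam : CopDual k A →ₗ[k] Module.End k (CopDual k A ⊗[k] A) :=
  LinearMap.rTensorHom A ∘ₗ LinearMap.mul k (CopDual k A)

@[simp] theorem lam_tmul (f l : CopDual k A) (w : A) : lam f (l ⊗ₜ w) = (f * l) ⊗ₜ w := by
  simp [lam]

/-- The multiplication `(f ⊗ y)(l ⊗ z) = f ⋅ adj(y' ⊗ y''')(l) ⊗ y''z` of the double; thus
`A°` and `A` are subalgebras, and `y ⋅ l = ⟨l', y'⟩ ⟨S(l'''), y'''⟩ l'' ⋅ y''`. -/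
def mulD : CopDual k A ⊗[k] A →ₗ[k] Module.End k (CopDual k A ⊗[k] A) :=
  TensorProduct.lift ((LinearMap.mul k (Module.End k (CopDual k A ⊗[k] A))).compl₁₂ lam rho)

@[simp] theorem mulD_tmul (f : CopDual k A) (y : A) : mulD (f ⊗ₜ y) = lam f * rho y := by
  simp [mulD]

theorem adj_mul (a b c d : A) : adj (k := k) ((a * b) ⊗ₜ (c * d)) = adj (a ⊗ₜ c) * adj (b ⊗ₜ d) :=
  LinearMap.ext fun l => CopDual.ext fun x => by
    simp [antipodeInv_mul, mul_assoc]

theorem act_mul (u v : A ⊗[k] (A ⊗[k] A)) : act (u * v) = act u * act v := by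
  induction u with
  | zero => simp
  | add x y hx hy => simp only [add_mul, map_add, hx, hy]
  | tmul a u =>
  induction u with
  | zero => simp
  | add x y hx hy => simp only [add_mul, map_add, TensorProduct.tmul_add, hx, hy]
  | tmul b c =>
  induction v with
  | zero => simp
  | add x y hx hy => simp only [mul_add, map_add, hx, hy]
  | tmul a' v =>
  induction v with
  | zero => simp
  | add x y hx hy => simp only [mul_add, map_add, TensorProduct.tmul_add, hx, hy]
  | tmul b' c' =>
  refine TensorProduct.ext' fun l w => ?_
  simp [adj_mul, mul_assoc]

theorem comul₃_mul (y z : A) : comul₃ k A (y * z) = comul₃ k A y * comul₃ k A z := by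
  have h : ∀ s : A ⊗[k] A, LinearMap.lTensor A (comul (R := k)) s =
    Algebra.TensorProduct.map (.id k A) (Bialgebra.comulAlgHom k A) s := fun _ => rfl
  simp only [comul₃, LinearMap.comp_apply, Bialgebra.comul_mul, h, map_mul]

theorem rho_mul (y z : A) : rho (k := k) (y * z) = rho y * rho z := by
  simp [rho, comul₃_mul, act_mul]

theorem adj_one : adj (k := k) ((1 : A) ⊗ₜ (1 : A)) = 1 :=
  LinearMap.ext fun l => CopDual.ext fun x => by simp

theorem rho_one : rho (k := k) (1 : A) = 1 := by
  refine TensorProduct.ext' fun l w => ?_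
  simp [rho, comul₃, Algebra.TensorProduct.one_def, adj_one]

theorem lam_mul (f g : CopDual k A) : lam (f * g) = lam f * lam g :=
  TensorProduct.ext' fun l w => by simp [mul_assoc]

theorem lam_one : lam (1 : CopDual k A) = 1 :=
  TensorProduct.ext' fun l w => by simp

open CoassocSimps in
theorem comul₅  :
   (TensorProduct.assoc k A A (A ⊗[k] (A ⊗[k] A))).toLinearMap ∘ₗ
      TensorProduct.map (comul (R := k) (A := A)) (LinearMap.lTensor A comul) ∘ₗ comul₃ k A =
    LinearMap.lTensor A (LinearMap.lTensor A (TensorProduct.assoc k A A A).toLinearMap ∘ₗ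
      (TensorProduct.assoc k A (A ⊗[k] A) A).toLinearMap) ∘ₗ
      LinearMap.lTensor A (LinearMap.rTensor A (comul₃ k A)) ∘ₗ comul₃ k A := by
  simp only [comul₃, coassoc_simps]

theorem adj_mul_apply (p r : A) (g l : CopDual k A) : adj (p ⊗ₜ r) (g * l) =
    LinearMap.mul' k _ (TensorProduct.map (LinearMap.applyₗ g ∘ₗ adj) (LinearMap.applyₗ l ∘ₗ adj)
      (TensorProduct.tensorTensorTensorComm k A A A A
        (comul p ⊗ₜ[k] TensorProduct.comm k A A (comul r)))) := by
  refine CopDual.ext fun c => ?_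
  rw [toDual_adj, toDual_mul, Bialgebra.comul_mul, Bialgebra.comul_mul, comul_antipodeInv]
  generalize comul (R := k) p = u
  generalize comul (R := k) r = v
  induction u with
  | zero => simp
  | add x y hx hy => simp only [mul_add, map_add, TensorProduct.add_tmul, hx, hy, LinearMap.add_apply]
  | tmul p₁ p₂ =>
  induction v with
  | zero => simp
  | add x y hx hy =>
    simp only [add_mul, map_add, TensorProduct.tmul_add, hx, hy, LinearMap.add_apply]
  | tmul r₁ r₂ =>
  simp only [TensorProduct.comm_tmul, TensorProduct.map_tmul, LinearMap.mul'_apply,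
    TensorProduct.tensorTensorTensorComm_tmul, LinearMap.comp_apply,
    LinearMap.applyₗ_apply_apply, toDual_mul]
  generalize comul (R := k) c = w
  induction w with
  | zero => simp
  | add x y hx hy => simp only [mul_add, add_mul, map_add, hx, hy]
  | tmul c₁ c₂ => simp

/-- `p ⊗ q ⊗ r ⊗ s ⊗ t ↦ (adj(p ⊗ t)(g) ⋅ adj(q ⊗ s)(l)) ⊗ rw`. -/
def xi (g l : CopDual k A) (w : A) :
    A ⊗[k] (A ⊗[k] (A ⊗[k] (A ⊗[k] A))) →ₗ[k] CopDual k A ⊗[k] A :=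
  TensorProduct.map (LinearMap.mul' k _ ∘ₗ TensorProduct.map (LinearMap.applyₗ g ∘ₗ adj)
    (LinearMap.applyₗ l ∘ₗ adj)) (LinearMap.mulRight k w) ∘ₗ
  (TensorProduct.assoc k _ _ _).symm.toLinearMap ∘ₗ (TensorProduct.assoc k _ _ _).symm.toLinearMap ∘ₗ
  LinearMap.lTensor A ((TensorProduct.leftComm k _ _ _).toLinearMap ∘ₗ
    (TensorProduct.assoc k _ _ _).symm.toLinearMap ∘ₗ LinearMap.lTensor A (
      LinearMap.lTensor A (TensorProduct.comm k A A).toLinearMap ∘ₗ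
        (TensorProduct.leftComm k A A A).toLinearMap))

@[simp] theorem xi_tmul (g l : CopDual k A) (w p q r s t : A) :
    xi g l w (p ⊗ₜ (q ⊗ₜ (r ⊗ₜ (s ⊗ₜ t)))) =
      (adj (p ⊗ₜ t) g * adj (q ⊗ₜ s) l) ⊗ₜ (r * w) := by
  simp [xi]

theorem rho_lam (y : A) (g : CopDual k A) : rho y * lam g = mulD (rho y (g ⊗ₜ 1)) := by
  refine TensorProduct.ext' fun l w => ?_
  have h := congr(xi g l w ($(comul₅ (k := k)) y))
  simp only [LinearMap.comp_apply] at h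
  have h1 : ∀ t : A ⊗[k] (A ⊗[k] A), act t ((g * l) ⊗ₜ w) =
      xi g l w (TensorProduct.assoc k A A (A ⊗[k] (A ⊗[k] A))
        (TensorProduct.map (comul (R := k) (A := A)) (LinearMap.lTensor A comul) t)) := by
    intro t
    induction t with
    | zero => simp
    | add x y hx hy => simp only [map_add, LinearMap.add_apply, hx, hy]
    | tmul p t =>
    induction t with
    | zero => simp
    | add x y hx hy => simp only [map_add, LinearMap.add_apply, TensorProduct.tmul_add, hx, hy]
    | tmul q r =>
    rw [act_tmul, adj_mul_apply, TensorProduct.map_tmul, LinearMap.lTensor_tmul]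
    generalize comul (R := k) p = u
    generalize comul (R := k) r = v
    induction u with
    | zero => simp
    | add x y hx hy => simp only [map_add, TensorProduct.add_tmul, hx, hy]
    | tmul p₁ p₂ =>
    induction v with
    | zero => simp
    | add x y hx hy => simp only [map_add, TensorProduct.tmul_add, TensorProduct.add_tmul, hx, hy]
    | tmul r₁ r₂ => simp
  have h2 : ∀ t : A ⊗[k] (A ⊗[k] A), mulD (act t (g ⊗ₜ 1)) (l ⊗ₜ w) =
      xi g l w (LinearMap.lTensor A (LinearMap.lTensor A (TensorProduct.assoc k A A A).toLinearMap ∘ₗ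
        (TensorProduct.assoc k A (A ⊗[k] A) A).toLinearMap)
          (LinearMap.lTensor A (LinearMap.rTensor A (comul₃ k A)) t)) := by
    intro t
    induction t with
    | zero => simp
    | add x y hx hy => simp only [map_add, LinearMap.add_apply, hx, hy]
    | tmul p t =>
    induction t with
    | zero => simp
    | add x y hx hy => simp only [map_add, LinearMap.add_apply, TensorProduct.tmul_add, hx, hy]
    | tmul q r =>
    simp only [act_tmul, mul_one, mulD_tmul, Module.End.mul_apply, rho, LinearMap.comp_apply,
      LinearMap.lTensor_tmul, LinearMap.rTensor_tmul, LinearEquiv.coe_coe]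
    generalize comul₃ k A q = u
    induction u with
    | zero => simp
    | add x y hx hy =>
      simp only [map_add, LinearMap.add_apply, TensorProduct.tmul_add, TensorProduct.add_tmul, hx, hy]
    | tmul q₁ u =>
    induction u with
    | zero => simp
    | add x y hx hy =>
      simp only [map_add, LinearMap.add_apply, TensorProduct.tmul_add, TensorProduct.add_tmul, hx, hy]
    | tmul q₂ q₃ => simp
  rw [Module.End.mul_apply, lam_tmul, rho, LinearMap.comp_apply, h1, h2]
  exact h

theorem mulD_lam (f : CopDual k A) (t : CopDual k A ⊗[k] A) : mulD (lam f t) = lam f * mulD t := by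
  induction t with
  | zero => simp
  | add x y hx hy => simp only [map_add, mul_add, hx, hy]
  | tmul l y => simp [lam_mul, mul_assoc]

theorem mulD_mulRight (z : A) (t : CopDual k A ⊗[k] A) :
    mulD (LinearMap.lTensor _ (LinearMap.mulRight k z) t) = mulD t * rho z := by
  induction t with
  | zero => simp
  | add x y hx hy => simp only [map_add, add_mul, hx, hy]
  | tmul l y => simp [rho_mul, mul_assoc]

theorem rho_tmul (y z : A) (l : CopDual k A) : rho y (l ⊗ₜ z) =
    LinearMap.lTensor _ (LinearMap.mulRight k z) (rho y (l ⊗ₜ 1)) := by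
  simp only [rho, LinearMap.comp_apply]
  generalize comul₃ k A y = t
  induction t with
  | zero => simp
  | add x y hx hy => simp only [map_add, LinearMap.add_apply, hx, hy]
  | tmul p t =>
  induction t with
  | zero => simp
  | add x y hx hy => simp only [map_add, LinearMap.add_apply, TensorProduct.tmul_add, hx, hy]
  | tmul q r => simp

theorem mulD_mulD (s t : CopDual k A ⊗[k] A) : mulD (mulD s t) = mulD s * mulD t := by
  induction s with
  | zero => simp
  | add x y hx hy => simp only [map_add, add_mul, LinearMap.add_apply, hx, hy]
  | tmul f y =>
  induction t with
  | zero => simp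
  | add x y hx hy => simp only [map_add, mul_add, hx, hy]
  | tmul g z =>
  rw [mulD_tmul, Module.End.mul_apply, mulD_lam, rho_tmul, mulD_mulRight, ← rho_lam, mulD_tmul]
  simp only [mul_assoc]

theorem mulD_one : mulD ((1 : CopDual k A) ⊗ₜ[k] (1 : A)) = 1 := by
  simp [lam_one, rho_one]

theorem rho_one_tmul_one (y : A) : rho y ((1 : CopDual k A) ⊗ₜ[k] (1 : A)) = 1 ⊗ₜ y := by
  have h1 : ∀ t : A ⊗[k] (A ⊗[k] A), act t ((1 : CopDual k A) ⊗ₜ 1) =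
      1 ⊗ₜ[k] TensorProduct.lid k A (LinearMap.rTensor A counit
        (LinearMap.lTensor A ((TensorProduct.rid k A).toLinearMap ∘ₗ
          LinearMap.lTensor A (counit (R := k))) t)) := by
    intro t
    induction t with
    | zero => simp
    | add x y hx hy => simp only [map_add, LinearMap.add_apply, TensorProduct.tmul_add, hx, hy]
    | tmul p t =>
    induction t with
    | zero => simp
    | add x y hx hy => simp only [map_add, LinearMap.add_apply, TensorProduct.tmul_add, hx, hy]
    | tmul q r =>
    have h2 : adj (p ⊗ₜ r) (1 : CopDual k A) = (counit (R := k) p * counit (R := k) r) • 1 :=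
      CopDual.ext fun c => by simp; ring
    simp [h2, TensorProduct.smul_tmul, smul_smul, mul_comm]
  have h3 : ((TensorProduct.rid k A).toLinearMap ∘ₗ LinearMap.lTensor A (counit (R := k))) ∘ₗ
      comul = .id := by
    rw [LinearMap.comp_assoc, lTensor_counit_comp_comul]
    ext; simp
  rw [rho, LinearMap.comp_apply, h1, comul₃, LinearMap.comp_apply,
    ← LinearMap.lTensor_comp_apply, h3]
  simp

theorem mulD_one_right (s : CopDual k A ⊗[k] A) : mulD s (1 ⊗ₜ 1) = s := by
  induction s with
  | zero => simp
  | add x y hx hy => simp only [map_add, LinearMap.add_apply, hx, hy]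
  | tmul f y =>
  rw [mulD_tmul, Module.End.mul_apply]
  simp [rho_one_tmul_one]

instance : Mul (Double k A) := ⟨fun s t => mulD s t⟩
instance : One (Double k A) := ⟨(1 : CopDual k A) ⊗ₜ[k] (1 : A)⟩

instance : Ring (Double k A) :=
  { (inferInstance : AddCommGroup (Double k A)), (inferInstance : Mul (Double k A)),
    (inferInstance : One (Double k A)) with
    zero_mul := fun s => LinearMap.congr_fun (map_zero mulD) s
    mul_zero := fun s => map_zero (mulD s)
    left_distrib := fun s t u => map_add (mulD s) t u
    right_distrib := fun s t u => LinearMap.congr_fun (map_add mulD s t) u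
    mul_assoc := fun s t u => LinearMap.congr_fun (mulD_mulD s t) u
    one_mul := fun s => LinearMap.congr_fun mulD_one s
    mul_one := fun s => mulD_one_right s }

instance : Algebra k (Double k A) := Algebra.ofModule
  (fun r s t => LinearMap.congr_fun (map_smul mulD r s) t) (fun r s t => map_smul (mulD s) r t)

/-- The tensor `l ⊗ y`, as an element of the double. -/
def Double.of : CopDual k A ⊗[k] A ≃ₗ[k] Double k A := LinearEquiv.refl k _

theorem Double.of_mul_of (s t : CopDual k A ⊗[k] A) :
    Double.of s * Double.of t = Double.of (mulD s t) := rfl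

theorem Double.one_def : (1 : Double k A) = Double.of (1 ⊗ₜ 1) := rfl

/-- The inclusion `A° → D(A)`. -/
def Double.inl : CopDual k A →ₐ[k] Double k A :=
  AlgHom.ofLinearMap (Double.of.toLinearMap ∘ₗ (TensorProduct.mk k (CopDual k A) A).flip 1) rfl
    fun f g => by simp [Double.of_mul_of, rho_one]

/-- The inclusion `A → D(A)`. -/
def Double.inr : A →ₐ[k] Double k A :=
  AlgHom.ofLinearMap (Double.of.toLinearMap ∘ₗ TensorProduct.mk k (CopDual k A) A 1) rfl
    fun y z => by simp [Double.of_mul_of, lam_one, rho_tmul y z, rho_one_tmul_one]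

theorem Double.inl_apply (l : CopDual k A) : Double.inl l = Double.of (l ⊗ₜ[k] (1 : A)) := rfl

theorem Double.inr_apply (y : A) : Double.inr y = Double.of ((1 : CopDual k A) ⊗ₜ[k] y) := rfl

theorem Double.inl_mul_of (f : CopDual k A) (t : CopDual k A ⊗[k] A) :
    Double.inl f * Double.of t = Double.of (lam f t) := by
  simp [Double.inl_apply, Double.of_mul_of, rho_one]

theorem Double.inr_mul_of (y : A) (t : CopDual k A ⊗[k] A) :
    Double.inr y * Double.of t = Double.of (rho y t) := by
  simp [Double.inr_apply, Double.of_mul_of, lam_one]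

theorem Double.inl_mul_inr (l : CopDual k A) (y : A) :
    Double.inl l * Double.inr y = Double.of (l ⊗ₜ[k] y) := by
  simp [Double.inl_mul_of, Double.inr_apply]

theorem Double.of_mul_inr (t : CopDual k A ⊗[k] A) (z : A) :
    Double.of t * Double.inr z = Double.of (LinearMap.lTensor _ (LinearMap.mulRight k z) t) := by
  induction t with
  | zero => simp
  | add x y hx hy => simp only [map_add, add_mul, hx, hy]
  | tmul l y =>
    rw [← Double.inl_mul_inr, mul_assoc, ← map_mul, Double.inl_mul_inr]
    simp

/-- The comultiplication `Δ(l ⋅ y) = (l' ⋅ y') ⊗ (l'' ⋅ y'')` and counit `ε(l ⋅ y) = ⟨l, 1⟩ ε(y)`. -/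
instance : Coalgebra k (Double k A) := inferInstanceAs (Coalgebra k (CopDual k A ⊗[k] A))

/-- `(l ⊗ m) ⊗ (y ⊗ z) ↦ (l ⊗ y) ⊗ (m ⊗ z)`. -/
def Double.of₂ : (CopDual k A ⊗[k] CopDual k A) ⊗[k] (A ⊗[k] A) →ₗ[k]
    Double k A ⊗[k] Double k A :=
  TensorProduct.map Double.of.toLinearMap Double.of.toLinearMap ∘ₗ
    (TensorProduct.tensorTensorTensorComm k _ _ _ _).toLinearMap

@[simp] theorem Double.of₂_tmul (l m : CopDual k A) (y z : A) :
    Double.of₂ ((l ⊗ₜ[k] m) ⊗ₜ[k] (y ⊗ₜ[k] z)) = Double.of (l ⊗ₜ y) ⊗ₜ Double.of (m ⊗ₜ z) := by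
  simp [Double.of₂]

theorem Double.comul_of (l : CopDual k A) (y : A) :
    comul (R := k) (Double.of (l ⊗ₜ[k] y)) = Double.of₂ (comul l ⊗ₜ comul y) := by
  have h : (TensorProduct.map (Double.of (k := k) (A := A)).toLinearMap
      (Double.of (k := k) (A := A)).toLinearMap) ∘ₗ comul (R := k) (A := CopDual k A ⊗[k] A) =
      comul (R := k) (A := Double k A) ∘ₗ (Double.of (k := k) (A := A)).toLinearMap := by
    have : TensorProduct.map (Double.of (k := k) (A := A)).toLinearMap
      (Double.of (k := k) (A := A)).toLinearMap = LinearMap.id := TensorProduct.map_id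
    rw [this]; rfl
  have h2 := LinearMap.congr_fun h (l ⊗ₜ y)
  rw [LinearMap.comp_apply, LinearMap.comp_apply, TensorProduct.comul_tmul] at h2
  exact h2.symm

theorem Double.counit_of (l : CopDual k A) (y : A) :
    counit (R := k) (Double.of (l ⊗ₜ[k] y)) = toDual l 1 * counit y := by
  have h : counit (R := k) (Double.of (l ⊗ₜ[k] y)) = counit (l ⊗ₜ[k] y) := rfl
  rw [h, TensorProduct.counit_tmul]
  simp [mul_comm]

theorem Double.of₂_mul_left (s t : CopDual k A ⊗[k] CopDual k A) (v : A ⊗[k] A) :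
    Double.of₂ (s ⊗ₜ 1) * Double.of₂ (t ⊗ₜ v) = Double.of₂ ((s * t) ⊗ₜ v) := by
  rw [Algebra.TensorProduct.one_def]
  induction s with
  | zero => simp
  | add x y hx hy => simp only [map_add, add_mul, TensorProduct.add_tmul, hx, hy]
  | tmul f f' =>
  induction t with
  | zero => simp
  | add x y hx hy => simp only [map_add, mul_add, TensorProduct.add_tmul, hx, hy]
  | tmul g g' =>
  induction v with
  | zero => simp
  | add x y hx hy => simp only [map_add, mul_add, TensorProduct.tmul_add, hx, hy]
  | tmul y z =>
    simp [← Double.inl_apply, Double.inl_mul_of]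

theorem Double.of₂_mul_right (s : CopDual k A ⊗[k] CopDual k A) (u v : A ⊗[k] A) :
    Double.of₂ (s ⊗ₜ u) * Double.of₂ (1 ⊗ₜ v) = Double.of₂ (s ⊗ₜ (u * v)) := by
  rw [Algebra.TensorProduct.one_def]
  induction s with
  | zero => simp
  | add x y hx hy => simp only [map_add, add_mul, TensorProduct.add_tmul, hx, hy]
  | tmul f f' =>
  induction u with
  | zero => simp
  | add x y hx hy => simp only [map_add, add_mul, TensorProduct.tmul_add, hx, hy]
  | tmul g g' =>
  induction v with
  | zero => simp
  | add x y hx hy => simp only [map_add, mul_add, TensorProduct.tmul_add, hx, hy]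
  | tmul y z =>
    simp [← Double.inr_apply, Double.of_mul_inr]

theorem Double.comul_inl (l : CopDual k A) :
    comul (R := k) (Double.inl l) = Double.of₂ (comul l ⊗ₜ 1) := by
  rw [Double.inl_apply, Double.comul_of, Bialgebra.comul_one]

theorem Double.comul_inr (y : A) :
    comul (R := k) (Double.inr y) = Double.of₂ (1 ⊗ₜ comul y) := by
  rw [Double.inr_apply, Double.comul_of, Bialgebra.comul_one]

theorem Double.comul_inl_mul (l : CopDual k A) (d : Double k A) :
    comul (R := k) (Double.inl l * d) = comul (Double.inl l) * comul d := by
  obtain ⟨t, rfl⟩ := Double.of.surjective d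
  induction t with
  | zero => simp
  | add x y hx hy => simp only [map_add, mul_add, hx, hy]
  | tmul m y =>
    rw [Double.inl_mul_of, lam_tmul, Double.comul_inl, Double.comul_of, Double.comul_of,
      Double.of₂_mul_left, Bialgebra.comul_mul]

theorem Double.comul_mul_inr (d : Double k A) (z : A) :
    comul (R := k) (d * Double.inr z) = comul d * comul (Double.inr z) := by
  obtain ⟨t, rfl⟩ := Double.of.surjective d
  induction t with
  | zero => simp
  | add x y hx hy => simp only [map_add, add_mul, hx, hy]
  | tmul m y =>
    rw [Double.of_mul_inr, LinearMap.lTensor_tmul, LinearMap.mulRight_apply, Double.comul_inr,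
      Double.comul_of, Double.comul_of, Double.of₂_mul_right, Bialgebra.comul_mul]

theorem toDual₂_map_adj (p r u w a b : A) (s : CopDual k A ⊗[k] CopDual k A) :
    toDual₂ (TensorProduct.map (adj (p ⊗ₜ r)) (adj (u ⊗ₜ w)) s) (a ⊗ₜ b) =
      toDual₂ s ((antipodeInv k A r * (a * p)) ⊗ₜ (antipodeInv k A w * (b * u))) := by
  induction s with
  | zero => simp
  | add x y hx hy => simp only [map_add, LinearMap.add_apply, hx, hy]
  | tmul f g => simp

theorem comul_adj (p r : A) (l : CopDual k A) : comul (R := k) (adj (p ⊗ₜ r) l) =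
    TensorProduct.map (adj (p ⊗ₜ 1)) (adj (1 ⊗ₜ r)) (comul l) := by
  refine toDual₂_ext fun a b => ?_
  rw [toDual₂_map_adj, toDual₂_comul_tmul, toDual₂_comul_tmul, toDual_adj]
  simp [mul_assoc]

theorem adj_adj_cancel (p w x : A) (l : CopDual k A) :
    TensorProduct.homTensorHomMap (RingHom.id k) _ _ _ _
      (TensorProduct.map (adj ∘ₗ TensorProduct.mk k A A p) (adj ∘ₗ (TensorProduct.mk k A A).flip w)
        (comul (R := k) x)) (comul (R := k) l) =
    counit (R := k) x • TensorProduct.map (adj (p ⊗ₜ 1)) (adj (1 ⊗ₜ w)) (comul l) := by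
  refine toDual₂_ext fun a b => ?_
  have h : ∀ v : A ⊗[k] A, toDual₂ (TensorProduct.homTensorHomMap (RingHom.id k) _ _ _ _
      (TensorProduct.map (adj ∘ₗ TensorProduct.mk k A A p) (adj ∘ₗ (TensorProduct.mk k A A).flip w)
        v) (comul (R := k) l)) (a ⊗ₜ b) = toDual l (antipodeInv k A w * (b *
          (LinearMap.mul' k A (TensorProduct.map .id (antipodeInv k A)
            (TensorProduct.comm k A A v)) * (a * p)))) := by
    intro v
    induction v with
    | zero => simp
    | add x y hx hy => simp only [map_add, LinearMap.add_apply, add_mul, mul_add, hx, hy]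
    | tmul r u => simp [toDual₂_map_adj, toDual₂_comul_tmul, mul_assoc]
  rw [h, mul_antipodeInv, map_smul, LinearMap.smul_apply, toDual₂_map_adj, toDual₂_comul_tmul]
  simp [Algebra.algebraMap_eq_smul_one, mul_assoc]

open CoassocSimps in
theorem comul₆ :
    LinearMap.lTensor A (LinearMap.lTensor A (TensorProduct.assoc k A A (A ⊗[k] A)).symm.toLinearMap ∘ₗ
      (TensorProduct.assoc k A A (A ⊗[k] (A ⊗[k] A))).toLinearMap) ∘ₗ
      (TensorProduct.assoc k A (A ⊗[k] A) (A ⊗[k] (A ⊗[k] A))).toLinearMap ∘ₗ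
        TensorProduct.map (comul₃ k A) (comul₃ k A) ∘ₗ comul =
    LinearMap.lTensor A (LinearMap.lTensor A (LinearMap.rTensor (A ⊗[k] A) comul)) ∘ₗ
      LinearMap.lTensor A (LinearMap.lTensor A (comul₃ k A)) ∘ₗ comul₃ k A := by
  simp only [comul₃, coassoc_simps]

theorem counit_comul₃ :
    (TensorProduct.lid k (A ⊗[k] A)).toLinearMap ∘ₗ LinearMap.rTensor (A ⊗[k] A) counit ∘ₗ
      comul₃ k A = comul := by
  have h : LinearMap.rTensor (A ⊗[k] A) (counit (R := k)) ∘ₗ LinearMap.lTensor A comul =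
      LinearMap.lTensor k comul ∘ₗ LinearMap.rTensor A counit := by
    rw [LinearMap.rTensor_comp_lTensor, LinearMap.lTensor_comp_rTensor]
  rw [comul₃, ← LinearMap.comp_assoc comul, h, LinearMap.comp_assoc,
    rTensor_counit_comp_comul]
  ext a
  simp

theorem Double.comul_inr_mul_inl (y : A) (l : CopDual k A) :
    comul (R := k) (Double.inr y * Double.inl l) = comul (Double.inr y) * comul (Double.inl l) := by
  let e := LinearEquiv.trans (TensorProduct.assoc k A (A ⊗[k] A) (A ⊗[k] (A ⊗[k] A)))
    (LinearEquiv.lTensor A (LinearEquiv.trans (TensorProduct.assoc k A A (A ⊗[k] (A ⊗[k] A)))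
      (LinearEquiv.lTensor A (TensorProduct.assoc k A A (A ⊗[k] A)).symm)))
  let M : A ⊗[k] (A ⊗[k] A) →ₗ[k] CopDual k A →ₗ[k] CopDual k A ⊗[k] A :=
    LinearMap.lcomp k _ ((TensorProduct.mk k (CopDual k A) A).flip 1) ∘ₗ act
  let N : (A ⊗[k] (A ⊗[k] A)) ⊗[k] (A ⊗[k] (A ⊗[k] A)) →ₗ[k] Double k A ⊗[k] Double k A :=
    TensorProduct.map Double.of.toLinearMap Double.of.toLinearMap ∘ₗ
      LinearMap.applyₗ (comul (R := k) l) ∘ₗ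
        TensorProduct.homTensorHomMap (RingHom.id k) _ _ _ _ ∘ₗ TensorProduct.map M M
  let J : A ⊗[k] A →ₗ[k] CopDual k A ⊗[k] CopDual k A :=
    LinearMap.applyₗ (comul (R := k) l) ∘ₗ TensorProduct.homTensorHomMap (RingHom.id k) _ _ _ _ ∘ₗ
      TensorProduct.map (adj ∘ₗ (TensorProduct.mk k A A).flip 1) (adj ∘ₗ TensorProduct.mk k A A 1)
  let G : A ⊗[k] (A ⊗[k] (A ⊗[k] A)) →ₗ[k] Double k A ⊗[k] Double k A :=
    Double.of₂ ∘ₗ LinearMap.rTensor _ J ∘ₗ (TensorProduct.assoc k _ _ _).symm.toLinearMap ∘ₗ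
      LinearMap.lTensor A ((TensorProduct.comm k _ _).toLinearMap ∘ₗ
        (TensorProduct.assoc k A A A).symm.toLinearMap)
  have hJ : ∀ p r, J (p ⊗ₜ r) = TensorProduct.map (adj (p ⊗ₜ 1)) (adj (1 ⊗ₜ r)) (comul l) := by
    intro p r
    simp [J]
  have hG : ∀ p q v w, G (p ⊗ₜ (q ⊗ₜ (v ⊗ₜ w))) =
      Double.of₂ (TensorProduct.map (adj (p ⊗ₜ 1)) (adj (1 ⊗ₜ w)) (comul l) ⊗ₜ (q ⊗ₜ v)) := by
    intro p q v w
    simp [G, hJ]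
  clear_value G
  have hN : ∀ p q r u v w, N ((p ⊗ₜ (q ⊗ₜ r)) ⊗ₜ (u ⊗ₜ (v ⊗ₜ w))) = Double.of₂
      (TensorProduct.map (adj (p ⊗ₜ r)) (adj (u ⊗ₜ w)) (comul (R := k) l) ⊗ₜ (q ⊗ₜ v)) := by
    intro p q r u v w
    simp only [N, M, LinearMap.comp_apply, TensorProduct.map_tmul, LinearMap.applyₗ_apply_apply,
      TensorProduct.homTensorHomMap_apply]
    generalize comul (R := k) l = s
    induction s with
    | zero => simp
    | add x y hx hy => simp only [map_add, TensorProduct.add_tmul, hx, hy]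
    | tmul f g => simp
  have hNe : ∀ t : A ⊗[k] (A ⊗[k] (A ⊗[k] (A ⊗[k] A))),
      N (e.symm (LinearMap.lTensor A (LinearMap.lTensor A (LinearMap.rTensor (A ⊗[k] A) comul)) t)) =
      G (LinearMap.lTensor A (LinearMap.lTensor A ((TensorProduct.lid k (A ⊗[k] A)).toLinearMap ∘ₗ
        LinearMap.rTensor (A ⊗[k] A) counit)) t) := by
    intro t
    have : N ∘ₗ e.symm.toLinearMap ∘ₗ
        LinearMap.lTensor A (LinearMap.lTensor A (LinearMap.rTensor (A ⊗[k] A) comul)) =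
      G ∘ₗ (LinearMap.lTensor A (LinearMap.lTensor A ((TensorProduct.lid k (A ⊗[k] A)).toLinearMap ∘ₗ
        LinearMap.rTensor (A ⊗[k] A) counit))) := by
      ext p q x v w
      have hX : ∀ X : A ⊗[k] A, N (e.symm (p ⊗ₜ (q ⊗ₜ (X ⊗ₜ (v ⊗ₜ w))))) =
          Double.of₂ (TensorProduct.homTensorHomMap (RingHom.id k) _ _ _ _
            (TensorProduct.map (adj ∘ₗ TensorProduct.mk k A A p)
              (adj ∘ₗ (TensorProduct.mk k A A).flip w) X) (comul (R := k) l) ⊗ₜ (q ⊗ₜ v)) := by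
        intro X
        induction X with
        | zero => simp
        | add x y hx hy =>
          simp only [map_add, TensorProduct.add_tmul, TensorProduct.tmul_add, LinearMap.add_apply,
            hx, hy]
        | tmul r u =>
          have : e.symm (p ⊗ₜ (q ⊗ₜ ((r ⊗ₜ u) ⊗ₜ (v ⊗ₜ w)))) = (p ⊗ₜ (q ⊗ₜ r)) ⊗ₜ (u ⊗ₜ (v ⊗ₜ w)) := by
            rw [LinearEquiv.symm_apply_eq]
            simp [e]
          rw [this, hN]
          simp
      simp only [TensorProduct.AlgebraTensorModule.curry_apply, LinearMap.restrictScalars_self,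
        TensorProduct.curry_apply, LinearMap.comp_apply, LinearMap.lTensor_tmul,
        LinearMap.rTensor_tmul, LinearEquiv.coe_coe, hX, adj_adj_cancel, TensorProduct.lid_tmul,
        TensorProduct.tmul_smul, map_smul, hG, ← TensorProduct.smul_tmul']
    exact LinearMap.congr_fun this t
  have h1 : comul (R := k) (Double.inr y * Double.inl l) =
      G (LinearMap.lTensor A (LinearMap.lTensor A comul) (comul₃ k A y)) := by
    have h : ∀ t : A ⊗[k] (A ⊗[k] A), comul (R := k) (Double.of (act t (l ⊗ₜ 1))) =
        G (LinearMap.lTensor A ((TensorProduct.assoc k A A A).toLinearMap ∘ₗ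
          LinearMap.rTensor A comul) t) := by
      intro t
      induction t with
      | zero => simp
      | add x y hx hy => simp only [map_add, LinearMap.add_apply, hx, hy]
      | tmul p t =>
      induction t with
      | zero => simp
      | add x y hx hy => simp only [map_add, LinearMap.add_apply, TensorProduct.tmul_add, hx, hy]
      | tmul q r =>
      rw [act_tmul, mul_one, Double.comul_of, comul_adj, LinearMap.lTensor_tmul,
        LinearMap.comp_apply, LinearMap.rTensor_tmul]
      generalize comul (R := k) q = u
      induction u with
      | zero => simp
      | add x y hx hy =>
        simp only [map_add, TensorProduct.add_tmul, TensorProduct.tmul_add, hx, hy]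
      | tmul q₁ q₂ => simp [hG]
    have h' : comul₃ k A y = LinearMap.lTensor A comul (comul y) := rfl
    rw [Double.inl_apply, Double.inr_mul_of, rho, LinearMap.comp_apply, h, h',
      ← LinearMap.lTensor_comp_apply, ← LinearMap.lTensor_comp_apply,
      LinearMap.comp_assoc, coassoc]
  have h2 : comul (R := k) (Double.inr y) * comul (Double.inl l) =
      N (TensorProduct.map (comul₃ k A) (comul₃ k A) (comul y)) := by
    rw [Double.comul_inr, Double.comul_inl]
    generalize comul (R := k) y = t
    simp only [N, LinearMap.comp_apply, LinearMap.applyₗ_apply_apply]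
    generalize comul (R := k) l = s
    induction t with
    | zero => simp
    | add x y hx hy =>
      simp only [map_add, LinearMap.add_apply, TensorProduct.tmul_add, add_mul, hx, hy]
    | tmul y₁ y₂ =>
    induction s with
    | zero => simp
    | add x y hx hy => simp only [map_add, TensorProduct.add_tmul, mul_add, hx, hy]
    | tmul f g =>
      simp only [Algebra.TensorProduct.one_def, Double.of₂_tmul, Algebra.TensorProduct.tmul_mul_tmul,
        ← Double.inr_apply, Double.inr_mul_of]
      simp [M, rho]
  have h3 := congr($(comul₆ (k := k) (A := A)) y)
  have h4 : e (TensorProduct.map (comul₃ k A) (comul₃ k A) (comul y)) = _ := h3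
  rw [h1, h2, ← e.symm_apply_apply (TensorProduct.map _ _ _), h4]
  simp only [LinearMap.comp_apply]
  rw [hNe, ← LinearMap.lTensor_comp_apply, ← LinearMap.lTensor_comp, LinearMap.comp_assoc,
    counit_comul₃]

theorem Double.comul_mul (c d : Double k A) :
    comul (R := k) (c * d) = comul c * comul d := by
  obtain ⟨s, rfl⟩ := Double.of.surjective c
  obtain ⟨t, rfl⟩ := Double.of.surjective d
  induction s with
  | zero => simp
  | add x y hx hy => simp only [map_add, add_mul, hx, hy]
  | tmul f y =>
  induction t with
  | zero => simp
  | add x y hx hy => simp only [map_add, mul_add, hx, hy]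
  | tmul l z =>
    simp only [← Double.inl_mul_inr]
    rw [mul_assoc, ← mul_assoc (Double.inr y), comul_inl_mul, comul_mul_inr, comul_inr_mul_inl,
      comul_mul_inr, comul_mul_inr]
    simp only [mul_assoc]

theorem Double.counit_inr_mul (y : A) (d : Double k A) :
    counit (R := k) (Double.inr y * d) = counit y * counit d := by
  obtain ⟨t, rfl⟩ := Double.of.surjective d
  induction t with
  | zero => simp
  | add x y hx hy => simp only [map_add, mul_add, hx, hy]
  | tmul l z =>
  have h : ∀ t : A ⊗[k] (A ⊗[k] A), counit (R := k) (Double.of (act t (l ⊗ₜ[k] z))) =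
      toDual l (LinearMap.mul' k A (TensorProduct.map (antipodeInv k A) .id
        (TensorProduct.comm k A A (LinearMap.lTensor A ((TensorProduct.lid k A).toLinearMap ∘ₗ
          LinearMap.rTensor A (counit (R := k))) t)))) * counit (R := k) z := by
    intro t
    induction t with
    | zero => simp
    | add x y hx hy => simp only [map_add, LinearMap.add_apply, add_mul, hx, hy]
    | tmul p t =>
    induction t with
    | zero => simp
    | add x y hx hy => simp only [map_add, LinearMap.add_apply, TensorProduct.tmul_add, add_mul, hx, hy]
    | tmul q r =>
      simp [Double.counit_of]
      ring
  have h3 : ((TensorProduct.lid k A).toLinearMap ∘ₗ LinearMap.rTensor A (counit (R := k))) ∘ₗ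
      comul = .id := by
    rw [LinearMap.comp_assoc, rTensor_counit_comp_comul]
    ext; simp
  rw [Double.inr_mul_of, rho, LinearMap.comp_apply, h, comul₃, LinearMap.comp_apply,
    ← LinearMap.lTensor_comp_apply, h3, LinearMap.lTensor_id, LinearMap.id_apply, antipodeInv_mul',
    Double.counit_of]
  simp [Algebra.algebraMap_eq_smul_one, mul_assoc]

theorem Double.counit_inl_mul (l : CopDual k A) (d : Double k A) :
    counit (R := k) (Double.inl l * d) = toDual l 1 * counit d := by
  obtain ⟨t, rfl⟩ := Double.of.surjective d
  induction t with
  | zero => simp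
  | add x y hx hy => simp only [map_add, mul_add, hx, hy]
  | tmul m y =>
    simp [Double.inl_mul_of, Double.counit_of, toDual_mul, Algebra.TensorProduct.one_def, mul_assoc]

instance : Bialgebra k (Double k A) :=
  Bialgebra.mk' k (Double k A) (by rw [Double.one_def, Double.counit_of]; simp)
    (by
      intro c d
      obtain ⟨s, rfl⟩ := Double.of.surjective c
      induction s with
      | zero => simp
      | add x y hx hy => simp only [map_add, add_mul, hx, hy]
      | tmul f y =>
        rw [← Double.inl_mul_inr, mul_assoc, Double.counit_inl_mul, Double.counit_inr_mul,
          Double.inl_mul_inr, Double.counit_of, mul_assoc])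
    (by
      rw [Double.one_def, Double.comul_of]
      simp [Algebra.TensorProduct.one_def, Double.one_def])
    (Double.comul_mul _ _)

/-- The antipode `S(l ⊗ y) = S(y) S(l)`. -/
def Double.antipode : Double k A →ₗ[k] Double k A :=
  LinearMap.mul' k _ ∘ₗ TensorProduct.map (Double.inr.toLinearMap ∘ₗ HopfAlgebra.antipode k)
    (Double.inl.toLinearMap ∘ₗ HopfAlgebra.antipode k) ∘ₗ
      (TensorProduct.comm k _ _).toLinearMap ∘ₗ Double.of.symm.toLinearMap

@[simp] theorem Double.antipode_of (l : CopDual k A) (y : A) :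
    Double.antipode (Double.of (l ⊗ₜ[k] y)) =
      Double.inr (HopfAlgebra.antipode k y) * Double.inl (HopfAlgebra.antipode k l) := by
  simp [Double.antipode]

theorem Double.mul_antipode_left (s : CopDual k A ⊗[k] CopDual k A) (y y' : A) :
    LinearMap.mul' k _ (LinearMap.rTensor (Double k A) Double.antipode
      (Double.of₂ (s ⊗ₜ (y ⊗ₜ y')))) = Double.inr (HopfAlgebra.antipode k y) * (Double.inl
        (LinearMap.mul' k _ (LinearMap.rTensor _ (HopfAlgebra.antipode k) s)) * Double.inr y') := by
  induction s with
  | zero => simp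
  | add x y hx hy => simp only [map_add, TensorProduct.add_tmul, add_mul, mul_add, hx, hy]
  | tmul f f' =>
    simp [← Double.inl_mul_inr f' y', mul_assoc]

theorem Double.mul_antipode_right (t : A ⊗[k] A) (f f' : CopDual k A) :
    LinearMap.mul' k _ (LinearMap.lTensor (Double k A) Double.antipode
      (Double.of₂ ((f ⊗ₜ f') ⊗ₜ t))) = Double.inl f * (Double.inr
        (LinearMap.mul' k _ (LinearMap.lTensor _ (HopfAlgebra.antipode k) t)) *
          Double.inl (HopfAlgebra.antipode k f')) := by
  induction t with
  | zero => simp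
  | add x y hx hy => simp only [map_add, TensorProduct.tmul_add, add_mul, mul_add, hx, hy]
  | tmul y y' =>
    simp [← Double.inl_mul_inr f y, mul_assoc]

instance : HopfAlgebra k (Double k A) where
  antipode := Double.antipode
  mul_antipode_rTensor_comul := by
    ext d
    obtain ⟨t, rfl⟩ := Double.of.surjective d
    induction t with
    | zero => simp
    | add x y hx hy => simp only [map_add, hx, hy]
    | tmul l y =>
    have h : ∀ t : A ⊗[k] A,
        LinearMap.mul' k _ (LinearMap.rTensor (Double k A) Double.antipode
          (Double.of₂ (comul l ⊗ₜ t))) = toDual l 1 • Double.inr (LinearMap.mul' k _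
            (LinearMap.rTensor _ (HopfAlgebra.antipode k) t)) := by
      intro t
      induction t with
      | zero => simp
      | add x y hx hy => simp only [map_add, TensorProduct.tmul_add, hx, hy, smul_add]
      | tmul y y' =>
        rw [Double.mul_antipode_left, HopfAlgebra.mul_antipode_rTensor_comul_apply]
        simp [Algebra.algebraMap_eq_smul_one]
    rw [LinearMap.comp_apply, LinearMap.comp_apply, Double.comul_of, h,
      HopfAlgebra.mul_antipode_rTensor_comul_apply, LinearMap.comp_apply, Double.counit_of]
    simp [Algebra.algebraMap_eq_smul_one, smul_smul]
  mul_antipode_lTensor_comul := by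
    ext d
    obtain ⟨t, rfl⟩ := Double.of.surjective d
    induction t with
    | zero => simp
    | add x y hx hy => simp only [map_add, hx, hy]
    | tmul l y =>
    have h : ∀ s : CopDual k A ⊗[k] CopDual k A,
        LinearMap.mul' k _ (LinearMap.lTensor (Double k A) Double.antipode
          (Double.of₂ (s ⊗ₜ comul y))) = counit (R := k) y • Double.inl (LinearMap.mul' k _
            (LinearMap.lTensor _ (HopfAlgebra.antipode k) s)) := by
      intro s
      induction s with
      | zero => simp
      | add x y hx hy => simp only [map_add, TensorProduct.add_tmul, hx, hy, smul_add]
      | tmul f f' =>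
        rw [Double.mul_antipode_right, HopfAlgebra.mul_antipode_lTensor_comul_apply]
        simp [Algebra.algebraMap_eq_smul_one]
    rw [LinearMap.comp_apply, LinearMap.comp_apply, Double.comul_of, h,
      HopfAlgebra.mul_antipode_lTensor_comul_apply, LinearMap.comp_apply, Double.counit_of]
    simp [Algebra.algebraMap_eq_smul_one, smul_smul, mul_comm]

end Double

section Integrals
variable {k H : Type*} [Field k] [Ring H] [HopfAlgebra k H]

/-- `μ` is a left integral: `(1 ⊗ μ) Δ(h) = μ(h) 1`. -/
def IsLeftIntegral (μ : Module.Dual k H) : Prop :=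
  ∀ h : H, TensorProduct.rid k H (LinearMap.lTensor H μ (comul h)) = μ h • (1 : H)

/-- `μ` is a right integral: `(μ ⊗ 1) Δ(h) = μ(h) 1`. -/
def IsRightIntegral (μ : Module.Dual k H) : Prop :=
  ∀ h : H, TensorProduct.lid k H (LinearMap.rTensor H μ (comul h)) = μ h • (1 : H)

variable (k) in
/-- `x` is a left cointegral: `h x = ε(h) x`. -/
def IsLeftCointegral (x : H) : Prop := ∀ h : H, h * x = counit (R := k) h • x

/-- The one dimensional representation `α` is the modulus belonging to the left cointegral `x`:
`x h = α(h) x`. -/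
def IsModulus (x : H) (α : H →ₐ[k] k) : Prop := ∀ h : H, x * h = α h • x

/-- The group like element `a` is the comodulus belonging to the left integral `μ`:
`(μ ⊗ 1) Δ(h) = μ(h) a`. -/
def IsComodulus (μ : Module.Dual k H) (a : H) : Prop :=
  IsGroupLikeElem k a ∧
    ∀ h : H, TensorProduct.lid k H (LinearMap.rTensor H μ (comul h)) = μ h • a

/-- `χ` is a `q`-character: `χ(yz) = χ(S²(z) y)`. -/
def IsQCharacter (χ : Module.Dual k H) : Prop :=
  ∀ y z : H, χ (y * z) = χ (antipode k (antipode k z) * y)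

end Integrals

section DoubleIntegrals
variable {k A : Type*} [Field k] [Ring A] [HopfAlgebra k A] [FiniteDimensional k A]
  [InvertibleAntipode k A]

/-- The linear form `μ_D(l ⋅ y) = l(x) μ(S(y))` on the double. -/
def doubleIntegral (μ : Module.Dual k A) (x : A) : Module.Dual k (Double k A) :=
  LinearMap.mul' k k ∘ₗ
    TensorProduct.map (LinearMap.applyₗ x ∘ₗ toDual.toLinearMap) (μ ∘ₗ antipode k) ∘ₗ
      Double.of.symm.toLinearMap

theorem doubleIntegral_inl_mul_inr (μ : Module.Dual k A) (x : A) (l : CopDual k A) (y : A) :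
    doubleIntegral μ x (Double.inl l * Double.inr y) = toDual l x * μ (antipode k y) := by
  simp [doubleIntegral, Double.inl_mul_inr]

/-- The element `p = μ ⋅ S⁻¹(x)` of the double. -/
def doubleCointegral (μ : Module.Dual k A) (x : A) : Double k A :=
  Double.inl (toDual.symm μ) * Double.inr (antipodeInv k A x)

variable {ι : Type*} [Fintype ι]

/-- `u = ∑ᵢ S(fᵢ) eᵢ`, where `fᵢ` is the basis of `A°` dual to the basis `eᵢ` of `A`. -/
def canonicalU (e : Module.Basis ι k A) : Double k A :=
  ∑ i, antipode k (Double.inl (toDual.symm (e.coord i))) * Double.inr (e i)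

/-- `û = ∑ᵢ S²(eᵢ) fᵢ`, where `fᵢ` is the basis of `A°` dual to the basis `eᵢ` of `A`. -/
def canonicalUHat (e : Module.Basis ι k A) : Double k A :=
  ∑ i, antipode k (antipode k (Double.inr (e i))) * Double.inl (toDual.symm (e.coord i))

/-- The canonical element `g = u û`. -/
def canonicalG (e : Module.Basis ι k A) : Double k A := canonicalU e * canonicalUHat e

end DoubleIntegrals

end HopfDouble

end

open HopfDouble

set_option linter.unusedSectionVars false

noncomputable section

open scoped TensorProduct

/-! Everything rests on the Frobenius property of `A`. From `μ` and `x` one gets x' μ(h x'') = S(h)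
(`IsLeftIntegral.sliceRight_mul_comul`), so f ↦ (1 ⊗ f)Δ(x) is a bijection A* → A and every linear
form is μ(h ·) for some h. Hence left integrals and cointegrals are unique up to scalars, and the
modulus α and comodulus a exist. Two refinements are needed: the Nakayama automorphism of μ
(`nakayama`) and the twisted cocommutativity x' ⊗ S²(x'') = x'' ⊗ x' a
(`lTensor_antipode_antipode_comul`).

As a coalgebra D(A) is A° ⊗ A, so invariance of a product form can be checked one factor at a time.
This makes μ_D a right integral, and makes l · y ↦ l(S⁻¹(x)) μ(y) a nonzero left integral with
comodulus a α⁻¹ (`isComodulus_productForm`). Left integrals of D(A) are its multiples, so a α⁻¹ is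
the comodulus of all nonzero ones.

To identify a α⁻¹ with g⁻¹, regard elements of D(A) as maps A → A through their slices. Then u
becomes S⁻¹, from which u y = S²(y) u for y in A, and this gives S(u) û = 1. Writing the canonical
tensor through the dual bases μ(· x') and a S(x'') gives S(u) = a α⁻¹ u (`antipode_canonicalU_eq`).
Together a α⁻¹ g = 1, and a α⁻¹ is a unit because it is group like.

For the q-character property it is enough to move generators around. Moving elements of A is the
Nakayama formula, and moving elements of A° is the twisted cocommutativity of Δ(x). The factor ω =
α(a) comes from evaluating μ_D(y · l) explicitly: the comodulus of μ contributes α(S(a)) = ω⁻¹. -/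

namespace HopfDouble
open Coalgebra HopfAlgebra

/-! ### Slice maps on A ⊗ A -/

section Slices
variable {k A : Type*} [Field k] [Ring A] [Algebra k A]

/-- The slice map `p ⊗ q ↦ f(q) p`. -/
def sliceRight (f : Module.Dual k A) : A ⊗[k] A →ₗ[k] A :=
  (TensorProduct.rid k A).toLinearMap ∘ₗ LinearMap.lTensor A f

/-- The slice map `p ⊗ q ↦ f(p) q`. -/
def sliceLeft (f : Module.Dual k A) : A ⊗[k] A →ₗ[k] A :=
  (TensorProduct.lid k A).toLinearMap ∘ₗ LinearMap.rTensor A f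

@[simp] theorem sliceRight_tmul (f : Module.Dual k A) (p q : A) :
    sliceRight f (p ⊗ₜ q) = f q • p := by simp [sliceRight]

@[simp] theorem sliceLeft_tmul (f : Module.Dual k A) (p q : A) :
    sliceLeft f (p ⊗ₜ q) = f p • q := by simp [sliceLeft]

theorem sliceRight_tmul_mul (f : Module.Dual k A) (p q : A) (t : A ⊗[k] A) :
    sliceRight f (p ⊗ₜ q * t) = p * sliceRight f (1 ⊗ₜ q * t) := by
  induction t with
  | zero => simp
  | add x y hx hy => simp only [map_add, mul_add, hx, hy]
  | tmul r s => simp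

theorem sliceRight_mul_tmul (f : Module.Dual k A) (p q : A) (t : A ⊗[k] A) :
    sliceRight f (t * p ⊗ₜ q) = sliceRight f (t * 1 ⊗ₜ q) * p := by
  induction t with
  | zero => simp
  | add x y hx hy => simp only [map_add, add_mul, hx, hy]
  | tmul r s => simp

theorem sliceLeft_tmul_mul (f : Module.Dual k A) (p q : A) (t : A ⊗[k] A) :
    sliceLeft f (p ⊗ₜ q * t) = q * sliceLeft f (p ⊗ₜ 1 * t) := by
  induction t with
  | zero => simp
  | add x y hx hy => simp only [map_add, mul_add, hx, hy]
  | tmul r s => simp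

theorem sliceRight_one_tmul_mul (f : Module.Dual k A) (q : A) (t : A ⊗[k] A) :
    sliceRight f (1 ⊗ₜ q * t) = sliceRight (f ∘ₗ LinearMap.mulLeft k q) t := by
  induction t with
  | zero => simp
  | add x y hx hy => simp only [map_add, mul_add, hx, hy]
  | tmul r s => simp

theorem sliceRight_mul_one_tmul (f : Module.Dual k A) (q : A) (t : A ⊗[k] A) :
    sliceRight f (t * 1 ⊗ₜ q) = sliceRight (f ∘ₗ LinearMap.mulRight k q) t := by
  induction t with
  | zero => simp
  | add x y hx hy => simp only [map_add, add_mul, hx, hy]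
  | tmul r s => simp

theorem sliceLeft_tmul_one_mul (f : Module.Dual k A) (q : A) (t : A ⊗[k] A) :
    sliceLeft f (q ⊗ₜ 1 * t) = sliceLeft (f ∘ₗ LinearMap.mulLeft k q) t := by
  induction t with
  | zero => simp
  | add x y hx hy => simp only [map_add, mul_add, hx, hy]
  | tmul r s => simp

theorem sliceRight_smul (c : k) (f : Module.Dual k A) (t : A ⊗[k] A) :
    sliceRight (c • f) t = c • sliceRight f t := by
  simp [sliceRight, LinearMap.lTensor_smul]

theorem sliceRight_comm (f : Module.Dual k A) (t : A ⊗[k] A) :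
    sliceRight f (TensorProduct.comm k A A t) = sliceLeft f t := by
  induction t with
  | zero => simp
  | add x y hx hy => simp only [map_add, hx, hy]
  | tmul r s => simp

theorem sliceRight_map (f : Module.Dual k A) (F G : A →ₗ[k] A) (t : A ⊗[k] A) :
    sliceRight f (TensorProduct.map F G t) = F (sliceRight (f ∘ₗ G) t) := by
  induction t with
  | zero => simp
  | add x y hx hy => simp only [map_add, hx, hy]
  | tmul r s => simp

theorem sliceLeft_map (f : Module.Dual k A) (F G : A →ₗ[k] A) (t : A ⊗[k] A) :
    sliceLeft f (TensorProduct.map F G t) = G (sliceLeft (f ∘ₗ F) t) := by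
  induction t with
  | zero => simp
  | add x y hx hy => simp only [map_add, hx, hy]
  | tmul r s => simp

/-- Tensors with equal right slices are equal. -/
theorem sliceRight_ext {s t : A ⊗[k] A} (h : ∀ f, sliceRight f s = sliceRight f t) : s = t := by
  classical
  let b := Module.Basis.ofVectorSpace k A
  have key : ∀ t : A ⊗[k] A, ∀ i,
      (TensorProduct.equivFinsuppOfBasisRight (M := A) b t) i = sliceRight (b.coord i) t := by
    intro t i
    induction t with
    | zero => simp
    | add x y hx hy => simp only [map_add, Finsupp.add_apply, hx, hy]
    | tmul r s => simp
  apply (TensorProduct.equivFinsuppOfBasisRight (M := A) b).injective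
  ext i
  rw [key, key, h]

/-- Tensors with equal left slices are equal. -/
theorem sliceLeft_ext {s t : A ⊗[k] A} (h : ∀ f, sliceLeft f s = sliceLeft f t) : s = t :=
  (TensorProduct.comm k A A).injective
    (sliceRight_ext fun f => by rw [sliceRight_comm, sliceRight_comm, h f])

theorem sliceLeft_comm (f : Module.Dual k A) (t : A ⊗[k] A) :
    sliceLeft f (TensorProduct.comm k A A t) = sliceRight f t := by
  rw [← sliceRight_comm, TensorProduct.comm_comm]

theorem dual_ext {a b : A} (h : ∀ f : Module.Dual k A, f a = f b) : a = b := by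
  rw [← sub_eq_zero]
  exact (Module.forall_dual_apply_eq_zero_iff k _).1 fun f => by simp [h f]

end Slices

/-! ### The Frobenius property: uniqueness of integrals, existence of modulus and comodulus -/

section Frobenius
variable {k A : Type*} [Field k] [Ring A] [HopfAlgebra k A]

theorem isLeftIntegral_iff (μ : Module.Dual k A) :
    IsLeftIntegral μ ↔ ∀ h : A, sliceRight μ (comul h) = μ h • (1 : A) := Iff.rfl

variable {μ : Module.Dual k A} {x : A}

theorem IsLeftIntegral.sliceRight_comul (hμ : IsLeftIntegral μ) (h : A) :
    sliceRight μ (comul h) = μ h • (1 : A) := hμ h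

theorem IsComodulus.sliceLeft_comul {a : A} (ha : IsComodulus μ a) (h : A) :
    sliceLeft μ (comul h) = μ h • a := ha.2 h

open WithConv in
-- The antipode is the convolution inverse of the identity, so convolving on the left with S turns
-- id * φ = c ε into φ = c S.
theorem eq_antipode_of_id_conv {φ : A →ₗ[k] A} {c : k}
    (h : ∀ y, LinearMap.mul' k A (TensorProduct.map .id φ (comul y)) = (c * counit y) • (1 : A)) (y : A) :
    φ y = c • antipode k y := by
  have h1 : toConv LinearMap.id * toConv φ = c • (1 : WithConv (A →ₗ[k] A)) := by
    ext y
    rw [LinearMap.convMul_apply]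
    simp [h y, Algebra.algebraMap_eq_smul_one, smul_smul]
  have h2 : toConv φ = c • toConv (antipode k (A := A)) := by
    calc toConv φ = (toConv (antipode k) * toConv LinearMap.id) * toConv φ := by simp
      _ = _ := by rw [mul_assoc, h1]; simp
  exact congr($h2 y)

/-- `x' μ(h x'') = μ(x) S(h)` -/
theorem IsLeftIntegral.sliceRight_mul_comul (hμ : IsLeftIntegral μ) (hx : IsLeftCointegral k x)
    (h : A) : sliceRight μ (1 ⊗ₜ h * comul x) = μ x • antipode k h := by
  let φ : A →ₗ[k] A := sliceRight μ ∘ₗ LinearMap.mulRight k (comul x) ∘ₗ TensorProduct.mk k A A 1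
  refine eq_antipode_of_id_conv (φ := φ) (fun y => ?_) h
  -- At s = Δ(y) the right side is (1 ⊗ μ)Δ(yx) = ε(y) μ(x) 1, so φ is a scalar multiple of the
  -- antipode.
  have key : ∀ s : A ⊗[k] A, LinearMap.mul' k A (TensorProduct.map .id φ s) =
      sliceRight μ (s * comul x) := by
    intro s
    induction s with
    | zero => simp
    | add x y hx hy => simp only [map_add, add_mul, hx, hy]
    | tmul r s => simp [φ, sliceRight_tmul_mul μ r s]
  rw [key, ← Bialgebra.comul_mul, hμ.sliceRight_comul, hx y]
  simp [mul_comm]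

variable [FiniteDimensional k A] [InvertibleAntipode k A]

/-- Slicing Δ(x) is surjective onto A, since b is the slice against μ(S⁻¹(b) ·). As A* and A have
the same finite dimension, it is injective too. -/
theorem sliceRight_comul_injective (hμ : IsLeftIntegral μ) (hx : IsLeftCointegral k x)
    (hμx : μ x = 1) {f g : Module.Dual k A}
    (h : sliceRight f (comul x) = sliceRight g (comul x)) : f = g := by
  let E : Module.Dual k A →ₗ[k] A :=
    { toFun := fun f => sliceRight f (comul x)
      map_add' := fun f g => by simp [sliceRight, LinearMap.lTensor_add]
      map_smul' := fun c f => by simp [sliceRight, LinearMap.lTensor_smul] }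
  have hs : Function.Surjective E := fun b =>
    ⟨μ ∘ₗ LinearMap.mulLeft k (antipodeInv k A b), by
      have := hμ.sliceRight_mul_comul hx (antipodeInv k A b)
      rw [sliceRight_one_tmul_mul] at this
      rwa [hμx, antipode_antipodeInv, one_smul] at this⟩
  exact (LinearMap.injective_iff_surjective_of_finrank_eq_finrank
    (Subspace.dual_finrank_eq (K := k) (V := A))).2 hs h

/-- A form is determined by its slice of Δ(x), and μ(h ·) has slice S(h); take h to be S⁻¹ of the
slice of f. -/
theorem exists_mulLeft_eq (hμ : IsLeftIntegral μ) (hx : IsLeftCointegral k x)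
    (hμx : μ x = 1) (f : Module.Dual k A) : ∃ h, f = μ ∘ₗ LinearMap.mulLeft k h := by
  refine ⟨antipodeInv k A (sliceRight f (comul x)), sliceRight_comul_injective hμ hx hμx ?_⟩
  rw [← sliceRight_one_tmul_mul, hμ.sliceRight_mul_comul hx, hμx]
  simp

/-- Slicing Δ(z) against μ(h ·) gives μ(z) S(h) for any left cointegral z, and these forms are all
of A*. So Δ(z) = μ(z) Δ(x), and the counit recovers z. -/
theorem IsLeftCointegral.eq_smul (hμ : IsLeftIntegral μ) (hx : IsLeftCointegral k x)
    (hμx : μ x = 1) {z : A} (hz : IsLeftCointegral k z) : z = μ z • x := by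
  have h : comul (R := k) z = comul (μ z • x) := by
    refine sliceRight_ext fun f => ?_
    obtain ⟨h, rfl⟩ := exists_mulLeft_eq hμ hx hμx f
    rw [← sliceRight_one_tmul_mul, ← sliceRight_one_tmul_mul, hμ.sliceRight_mul_comul hz, map_smul,
      mul_smul_comm, map_smul, hμ.sliceRight_mul_comul hx, hμx, one_smul]
  have h1 := congr(TensorProduct.lid k A (LinearMap.rTensor A (counit (R := k)) $h))
  simpa using h1

/-- Both sides have the slice ν(x) 1 on Δ(x). -/
theorem IsLeftIntegral.eq_smul (hμ : IsLeftIntegral μ) (hx : IsLeftCointegral k x)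
    (hμx : μ x = 1) {ν : Module.Dual k A} (hν : IsLeftIntegral ν) : ν = ν x • μ := by
  refine sliceRight_comul_injective hμ hx hμx ?_
  rw [sliceRight_smul, hν.sliceRight_comul, hμ.sliceRight_comul, hμx, one_smul]

/-- Each x h is again a left cointegral, so it is a multiple of x; the factor μ(xh) is
multiplicative in h by associativity. -/
theorem exists_isModulus (hμ : IsLeftIntegral μ) (hx : IsLeftCointegral k x)
    (hμx : μ x = 1) : ∃ α : A →ₐ[k] k, IsModulus x α := by
  have h : ∀ h : A, x * h = μ (x * h) • x := fun h =>
    IsLeftCointegral.eq_smul hμ hx hμx fun y => by rw [← mul_assoc, hx y, smul_mul_assoc]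
  refine ⟨AlgHom.ofLinearMap (μ ∘ₗ LinearMap.mulLeft k x) (by simp [hμx]) fun y z => ?_, h⟩
  simp only [LinearMap.comp_apply, LinearMap.mulLeft_apply]
  rw [← mul_assoc, h y, smul_mul_assoc, map_smul, smul_eq_mul, mul_comm (μ _) (μ _), mul_comm,
    ← h y]

/-- For every form f, h ↦ f((μ ⊗ 1)Δ(h)) is a left integral by coassociativity, hence a multiple of
μ. Evaluation at x forces a = (μ ⊗ 1)Δ(x), and coassociativity once more makes it group like. -/
theorem exists_isComodulus (hμ : IsLeftIntegral μ) (hx : IsLeftCointegral k x)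
    (hμx : μ x = 1) : ∃ a : A, IsComodulus μ a := by
  have hν : ∀ f : Module.Dual k A, IsLeftIntegral (f ∘ₗ sliceLeft μ ∘ₗ comul) := by
    intro f
    rw [isLeftIntegral_iff]
    intro h
    have h1 : ∀ t : A ⊗[k] A, sliceRight (f ∘ₗ sliceLeft μ ∘ₗ comul) t =
        (LinearMap.lTensor A comul t |> (TensorProduct.assoc k A A A).symm |>
          LinearMap.rTensor A (sliceRight μ) |> sliceRight f) := by
      intro t
      induction t with
      | zero => simp
      | add x y hx hy => simp only [map_add, hx, hy]
      | tmul r s =>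
        simp only [sliceRight_tmul, LinearMap.comp_apply, LinearMap.lTensor_tmul]
        generalize comul (R := k) s = u
        induction u with
        | zero => simp
        | add x y hx hy => simp only [map_add, add_smul, TensorProduct.tmul_add, hx, hy]
        | tmul v w => simp [smul_smul, mul_comm]
    have h2 : LinearMap.rTensor A (sliceRight μ) (LinearMap.rTensor A comul (comul h)) =
        1 ⊗ₜ[k] sliceLeft μ (comul h) := by
      rw [← LinearMap.rTensor_comp_apply]
      generalize comul (R := k) h = u
      induction u with
      | zero => simp
      | add x y hx hy => simp only [map_add, TensorProduct.tmul_add, hx, hy]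
      | tmul v w =>
        simp [hμ.sliceRight_comul, TensorProduct.smul_tmul]
    rw [h1, coassoc_symm_apply, h2]
    simp
  have ha : ∀ h, sliceLeft μ (comul h) = μ h • sliceLeft μ (comul x) := by
    intro h
    refine dual_ext (k := k) fun f => ?_
    have := LinearMap.congr_fun (IsLeftIntegral.eq_smul hμ hx hμx (hν f)) h
    simpa [mul_comm] using this
  refine ⟨sliceLeft μ (comul x), ⟨?_, ?_⟩, ha⟩
  · have h1 : ∀ t : A ⊗[k] A, counit (R := k) (sliceLeft μ t) =
        μ (TensorProduct.rid k A (LinearMap.lTensor A counit t)) := by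
      intro t
      induction t with
      | zero => simp
      | add x y hx hy => simp only [map_add, hx, hy]
      | tmul v w => simp [mul_comm]
    simp [h1, hμx]
  · have h1 : ∀ t : A ⊗[k] A, comul (R := k) (sliceLeft μ t) =
        LinearMap.rTensor A (sliceLeft μ) ((TensorProduct.assoc k A A A).symm
          (LinearMap.lTensor A comul t)) := by
      intro t
      induction t with
      | zero => simp
      | add x y hx hy => simp only [map_add, hx, hy]
      | tmul v w =>
        simp only [sliceLeft_tmul, LinearMap.lTensor_tmul, map_smul]
        generalize comul (R := k) w = u
        induction u with
        | zero => simp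
        | add x y hx hy => simp only [map_add, smul_add, TensorProduct.tmul_add, hx, hy]
        | tmul v w => simp [TensorProduct.smul_tmul']
    have h2 : ∀ t : A ⊗[k] A, LinearMap.rTensor A (sliceLeft μ) (LinearMap.rTensor A comul t) =
        sliceLeft μ (comul x) ⊗ₜ sliceLeft μ t := by
      intro t
      induction t with
      | zero => simp
      | add x y hx hy => simp only [map_add, TensorProduct.tmul_add, hx, hy]
      | tmul v w => simp [ha v, TensorProduct.smul_tmul]
    rw [h1, coassoc_symm_apply, h2]

end Frobenius

/-! ### The Nakayama automorphism of μ and the symmetry of Δ(x) -/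

section Nakayama
variable {k A : Type*} [Field k] [Ring A] [HopfAlgebra k A]
variable {μ : Module.Dual k A} {x : A} {α : A →ₐ[k] k} {a : A}

theorem comul_antipode_apply (h : A) : comul (R := k) (antipode k h) =
    TensorProduct.map (antipode k) (antipode k) (TensorProduct.comm k A A (comul h)) :=
  LinearMap.congr_fun comul_antipode h

/-- α ∘ S is the convolution inverse of α, so translation by α followed by translation by α ∘ S is
the identity: α(h' S(h'')) h''' = h. -/
theorem character_conv_cancel (α : A →ₐ[k] k) (h : A) :
    sliceLeft (α.toLinearMap ∘ₗ antipode k) (comul (R := k)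
      (sliceLeft α.toLinearMap (comul (R := k) h))) = h := by
  have h1 : ∀ t : A ⊗[k] A, sliceLeft (α.toLinearMap ∘ₗ antipode k) (comul (R := k)
      (sliceLeft α.toLinearMap t)) =
      TensorProduct.lid k A (LinearMap.rTensor A (α.toLinearMap ∘ₗ LinearMap.mul' k A ∘ₗ
        LinearMap.lTensor A (antipode k)) ((TensorProduct.assoc k A A A).symm
          (LinearMap.lTensor A comul t))) := by
    intro t
    induction t with
    | zero => simp
    | add x y hx hy => simp only [map_add, hx, hy]
    | tmul v w =>
      simp only [sliceLeft_tmul, LinearMap.lTensor_tmul, map_smul]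
      generalize comul (R := k) w = u
      induction u with
      | zero => simp
      | add x y hx hy => simp only [map_add, smul_add, TensorProduct.tmul_add, hx, hy]
      | tmul v w => simp [smul_smul]
  have h2 : (α.toLinearMap ∘ₗ LinearMap.mul' k A ∘ₗ LinearMap.lTensor A (antipode k)) ∘ₗ comul =
      counit (R := k) (A := A) := by
    ext y
    simp [mul_antipode_lTensor_comul_apply]
  rw [h1, coassoc_symm_apply, ← LinearMap.rTensor_comp_apply, h2]
  simp

open WithConv in
/-- `x' μ(x'' S(h)) = α(S(h')) h''`. -/
theorem sliceRight_comul_mul_antipode (hμ : IsLeftIntegral μ) (hμx : μ x = 1)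
    (hα : IsModulus x α) (h : A) : sliceRight μ (comul x * 1 ⊗ₜ antipode k h) =
      sliceLeft (α.toLinearMap ∘ₗ antipode k) (comul (R := k) h) := by
  let φ : A →ₗ[k] A := sliceRight μ ∘ₗ LinearMap.mulLeft k (comul x) ∘ₗ TensorProduct.mk k A A 1
  let χ : A →ₗ[k] A := φ ∘ₗ antipode k
  let β : A →ₗ[k] A := Algebra.linearMap k A ∘ₗ α.toLinearMap ∘ₗ antipode k
  -- χ * S at y is (1 ⊗ μ)(Δ(x) Δ(S(y))) = μ(x S(y)) 1 = α(S(y)) 1. Convolving on the right with the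
  -- identity then isolates χ.
  have h1 : toConv χ * toConv (antipode k) = toConv β := by
    ext y
    rw [LinearMap.convMul_apply]
    have key : ∀ t : A ⊗[k] A, LinearMap.mul' k A (TensorProduct.map χ (antipode k) t) =
        sliceRight μ (comul x * TensorProduct.map (antipode k) (antipode k)
          (TensorProduct.comm k A A t)) := by
      intro t
      induction t with
      | zero => simp
      | add x y hx hy => simp only [map_add, mul_add, hx, hy]
      | tmul v w => simp [χ, φ, sliceRight_mul_tmul μ (antipode k w)]
    rw [key, ← comul_antipode_apply, ← Bialgebra.comul_mul, hμ.sliceRight_comul, hα]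
    simp [β, Algebra.algebraMap_eq_smul_one, hμx]
  have h2 : toConv χ = toConv β * toConv LinearMap.id := by
    rw [← h1, mul_assoc, LinearMap.antipode_mul_id, mul_one]
  have h3 := congr($h2 h)
  rw [LinearMap.convMul_apply] at h3
  refine h3.trans ?_
  generalize comul (R := k) h = t
  induction t with
  | zero => simp
  | add x y hx hy => simp only [map_add, hx, hy]
  | tmul v w => simp [β, Algebra.algebraMap_eq_smul_one]

open WithConv in
/-- `S(x'' μ(h x')) = S(a) h`. -/
theorem antipode_sliceLeft_mul_comul (hx : IsLeftCointegral k x)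
    (hμx : μ x = 1) (ha : IsComodulus μ a) (h : A) :
    antipode k (sliceLeft μ (h ⊗ₜ 1 * comul x)) = antipode k a * h := by
  let φ : A →ₗ[k] A := sliceLeft μ ∘ₗ LinearMap.mulRight k (comul x) ∘ₗ
    (TensorProduct.mk k A A).flip 1
  let χ : A →ₗ[k] A := antipode k ∘ₗ φ
  let β : A →ₗ[k] A := LinearMap.mulLeft k (antipode k a) ∘ₗ Algebra.linearMap k A ∘ₗ counit
  -- χ * S at y is S((μ ⊗ 1)Δ(yx)) = ε(y) S(a), by the defining property of the comodulus.
  have h1 : toConv χ * toConv (antipode k) = toConv β := by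
    ext y
    rw [LinearMap.convMul_apply]
    have key : ∀ t : A ⊗[k] A, LinearMap.mul' k A (TensorProduct.map χ (antipode k) t) =
        antipode k (sliceLeft μ (t * comul x)) := by
      intro t
      induction t with
      | zero => simp
      | add x y hx hy => simp only [map_add, add_mul, hx, hy]
      | tmul v w => simp [χ, φ, sliceLeft_tmul_mul μ v w, antipode_mul_antidistrib]
    rw [key, ← Bialgebra.comul_mul, hx, map_smul, map_smul, ha.sliceLeft_comul]
    simp [β, Algebra.algebraMap_eq_smul_one, hμx]
  have h2 : toConv χ = toConv β * toConv LinearMap.id := by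
    rw [← h1, mul_assoc, LinearMap.antipode_mul_id, mul_one]
  have h3 := congr($h2 h)
  rw [LinearMap.convMul_apply] at h3
  refine h3.trans ?_
  have key : ∀ t : A ⊗[k] A, LinearMap.mul' k A (TensorProduct.map β .id t) =
      antipode k a * TensorProduct.lid k A (LinearMap.rTensor A counit t) := by
    intro t
    induction t with
    | zero => simp
    | add x y hx hy => simp only [map_add, mul_add, hx, hy]
    | tmul v w => simp [β, Algebra.algebraMap_eq_smul_one]
  exact (key _).trans (by simp)

/-- The dual bases `a S(x'')`, `μ(- x')`. -/
theorem mul_antipode_sliceLeft (hx : IsLeftCointegral k x)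
    (hμx : μ x = 1) (ha : IsComodulus μ a) (h : A) :
    a * antipode k (sliceLeft μ (h ⊗ₜ 1 * comul x)) = h := by
  rw [antipode_sliceLeft_mul_comul hx hμx ha, ← mul_assoc, ha.1.mul_antipode_cancel, one_mul]

variable [FiniteDimensional k A] [InvertibleAntipode k A]

/-- `S(x') μ(x'' h) = h' α(h'')`. -/
theorem antipode_sliceRight_comul_mul (hμ : IsLeftIntegral μ) (hμx : μ x = 1)
    (hα : IsModulus x α) (h : A) : antipode k (sliceRight μ (comul x * 1 ⊗ₜ h)) =
      sliceRight α.toLinearMap (comul (R := k) h) := by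
  obtain ⟨h, rfl⟩ : ∃ y, h = antipode k y := ⟨antipodeInv k A h, by simp⟩
  rw [sliceRight_comul_mul_antipode hμ hμx hα, comul_antipode_apply, sliceRight_map, sliceRight_comm]

/-- The Nakayama automorphism: `α(h') μ(w S(h'')) = μ(S⁻¹(h) w)`. -/
theorem nakayama (hμ : IsLeftIntegral μ) (hx : IsLeftCointegral k x) (hμx : μ x = 1)
    (hα : IsModulus x α) (h w : A) :
    μ (w * antipode k (sliceLeft α.toLinearMap (comul h))) = μ (antipodeInv k A h * w) := by
  -- As forms in w, both sides have slice h on Δ(x): on the left the translation by α cancels, on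
  -- the right S undoes S⁻¹.
  have := sliceRight_comul_injective hμ hx hμx
    (f := μ ∘ₗ LinearMap.mulRight k (antipode k (sliceLeft α.toLinearMap (comul h))))
    (g := μ ∘ₗ LinearMap.mulLeft k (antipodeInv k A h)) (by
      rw [← sliceRight_one_tmul_mul, ← sliceRight_mul_one_tmul, hμ.sliceRight_mul_comul hx, hμx,
        sliceRight_comul_mul_antipode hμ hμx hα, character_conv_cancel]
      simp)
  exact LinearMap.congr_fun this w

/-- `x' ⊗ S²(x'') = x'' ⊗ x' a`. -/
theorem lTensor_antipode_antipode_comul (hμ : IsLeftIntegral μ) (hx : IsLeftCointegral k x)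
    (hμx : μ x = 1) (ha : IsComodulus μ a) :
    LinearMap.lTensor A (antipode k ∘ₗ antipode k) (comul (R := k) x) =
      TensorProduct.comm k A A (comul x) * 1 ⊗ₜ a := by
  refine sliceLeft_ext fun f => ?_
  -- Against f = μ(h ·) the two sides become S(S(a) h) and S(h) a, which agree because S² fixes the
  -- group like element a.
  obtain ⟨h, rfl⟩ := exists_mulLeft_eq hμ hx hμx f
  have h1 : ∀ t : A ⊗[k] A, sliceLeft (μ ∘ₗ LinearMap.mulLeft k h)
      (TensorProduct.comm k A A t * 1 ⊗ₜ a) = sliceRight μ (1 ⊗ₜ h * t) * a := by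
    intro t
    induction t with
    | zero => simp
    | add x y hx hy => simp only [map_add, mul_add, add_mul, hx, hy]
    | tmul v w => simp
  rw [h1, hμ.sliceRight_mul_comul hx, LinearMap.lTensor, sliceLeft_map, LinearMap.comp_apply,
    LinearMap.comp_id, ← sliceLeft_tmul_one_mul, antipode_sliceLeft_mul_comul hx hμx ha,
    antipode_mul_antidistrib, ha.1.antipode_antipode, hμx, one_smul]

end Nakayama

/-! ### Cancellations in iterated comultiplications -/

section IteratedComul
variable {k A : Type*} [Field k] [Ring A] [HopfAlgebra k A]

theorem comul₃_eq_assoc (y : A) : comul₃ k A y =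
    TensorProduct.assoc k A A A (LinearMap.rTensor A comul (comul y)) :=
  (coassoc_apply y).symm

/-- S reverses comultiplication; the rearrangement on the right is the reversal y' ⊗ y'' ⊗ y''' ↦
y''' ⊗ y'' ⊗ y'. -/
theorem comul₃_antipode (y : A) : comul₃ k A (antipode k y) =
    TensorProduct.map (antipode k) (TensorProduct.map (antipode k) (antipode k))
      (LinearMap.lTensor A (TensorProduct.comm k A A).toLinearMap (TensorProduct.comm k _ _
        ((TensorProduct.assoc k A A A).symm (comul₃ k A y)))) := by
  rw [comul₃_eq_assoc y, LinearEquiv.symm_apply_apply, comul₃, LinearMap.comp_apply,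
    comul_antipode_apply]
  generalize comul (R := k) y = t
  induction t with
  | zero => simp
  | add x y hx hy => simp only [map_add, hx, hy]
  | tmul v w => simp [comul_antipode_apply]

variable [FiniteDimensional k A] [InvertibleAntipode k A]

/-- `w ⊗ z ⊗ t ↦ S⁻¹(z) w ⊗ t`. -/
def antipodeInvMul (M : Type*) [AddCommGroup M] [Module k M] : A ⊗[k] (A ⊗[k] M) →ₗ[k] A ⊗[k] M :=
  LinearMap.rTensor M (LinearMap.mul' k A ∘ₗ TensorProduct.map (antipodeInv k A) .id ∘ₗ
    (TensorProduct.comm k A A).toLinearMap) ∘ₗ (TensorProduct.assoc k A A M).symm.toLinearMap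

@[simp] theorem antipodeInvMul_tmul {M : Type*} [AddCommGroup M] [Module k M] (w z : A) (t : M) :
    antipodeInvMul (k := k) M (w ⊗ₜ (z ⊗ₜ t)) = (antipodeInv k A z * w) ⊗ₜ t := by
  simp [antipodeInvMul]

theorem antipodeInvMul_comul₃ (y : A) : antipodeInvMul A (comul₃ k A y) = 1 ⊗ₜ[k] y := by
  rw [comul₃_eq_assoc, antipodeInvMul, LinearMap.comp_apply, LinearEquiv.coe_coe,
    LinearEquiv.symm_apply_apply, ← LinearMap.rTensor_comp_apply]
  have h : (LinearMap.mul' k A ∘ₗ TensorProduct.map (antipodeInv k A) .id ∘ₗ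
      (TensorProduct.comm k A A).toLinearMap) ∘ₗ comul = Algebra.linearMap k A ∘ₗ counit := by
    ext a
    exact antipodeInv_mul' k a
  rw [h, LinearMap.rTensor_comp_apply, rTensor_counit_comul]
  simp

/-- `w ⊗ z ⊗ t ↦ z S⁻¹(w) ⊗ t`. -/
def mulAntipodeInv : A ⊗[k] (A ⊗[k] A) →ₗ[k] A ⊗[k] A :=
  LinearMap.rTensor A (LinearMap.mul' k A ∘ₗ TensorProduct.map .id (antipodeInv k A) ∘ₗ
    (TensorProduct.comm k A A).toLinearMap) ∘ₗ (TensorProduct.assoc k A A A).symm.toLinearMap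

@[simp] theorem mulAntipodeInv_tmul (w z t : A) :
    mulAntipodeInv (k := k) (w ⊗ₜ (z ⊗ₜ t)) = (z * antipodeInv k A w) ⊗ₜ t := by
  simp [mulAntipodeInv]

theorem mulAntipodeInv_comul₃ (y : A) : mulAntipodeInv (comul₃ k A y) = 1 ⊗ₜ[k] y := by
  rw [comul₃_eq_assoc, mulAntipodeInv, LinearMap.comp_apply, LinearEquiv.coe_coe,
    LinearEquiv.symm_apply_apply, ← LinearMap.rTensor_comp_apply]
  have h : (LinearMap.mul' k A ∘ₗ TensorProduct.map .id (antipodeInv k A) ∘ₗ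
      (TensorProduct.comm k A A).toLinearMap) ∘ₗ comul = Algebra.linearMap k A ∘ₗ counit := by
    ext a
    exact mul_antipodeInv k a
  rw [h, LinearMap.rTensor_comp_apply, rTensor_counit_comul]
  simp

/-- The rule S⁻¹(y'') y' = ε(y) applied to the first two of four legs. It removes the conjugating
factor in the computation of S(u). -/
theorem antipodeInvMul_lTensor_comul₃_comul (y : A) :
    antipodeInvMul (A ⊗[k] A) (LinearMap.lTensor A (comul₃ k A) (comul y)) =
      1 ⊗ₜ[k] comul (R := k) y := by
  have h : antipodeInvMul (k := k) (A ⊗[k] A) ∘ₗ LinearMap.lTensor A (LinearMap.lTensor A comul) =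
      LinearMap.lTensor A comul ∘ₗ antipodeInvMul (k := k) A := by
    ext w z t
    simp
  have h1 := LinearMap.congr_fun h (comul₃ k A y)
  simp only [LinearMap.comp_apply, antipodeInvMul_comul₃, LinearMap.lTensor_tmul] at h1
  rw [← h1]
  simp only [comul₃, LinearMap.lTensor_comp_apply, LinearMap.comp_apply]

end IteratedComul

/-! ### Elements of the double as linear maps A → A -/

section Slice
variable {k A : Type*} [Field k] [Ring A] [HopfAlgebra k A]
variable [FiniteDimensional k A] [InvertibleAntipode k A]

/-- The slice `l ⋅ y ↦ l(b) y` of the double. -/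
def Double.slice (b : A) : Double k A →ₗ[k] A := contract b ∘ₗ Double.of.symm.toLinearMap

@[simp] theorem Double.slice_of (b : A) (t : CopDual k A ⊗[k] A) :
    Double.slice b (Double.of t) = contract b t := by simp [Double.slice]

theorem Double.slice_ext {c d : Double k A} (h : ∀ b, Double.slice b c = Double.slice b d) :
    c = d :=
  Double.of.symm.injective (contract_ext h)

theorem Double.induction_on {P : Double k A → Prop} (d : Double k A)
    (add : ∀ c d, P c → P d → P (c + d)) (mul : ∀ l y, P (Double.inl l * Double.inr y)) : P d := by
  obtain ⟨t, rfl⟩ := Double.of.surjective d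
  induction t with
  | zero => simpa using mul 0 0
  | add x y hx hy => rw [map_add]; exact add _ _ hx hy
  | tmul l y => rw [← Double.inl_mul_inr]; exact mul l y

theorem Double.slice_mul_inr (b : A) (d : Double k A) (z : A) :
    Double.slice b (d * Double.inr z) = Double.slice b d * z := by
  induction d using Double.induction_on with
  | add x y hx hy => simp only [map_add, add_mul, hx, hy]
  | mul l y =>
    rw [mul_assoc, ← map_mul, Double.inl_mul_inr, Double.inl_mul_inr]
    simp

theorem toDual_mul_apply (l m : CopDual k A) (b : A) :
    toDual (l * m) b = toDual m (sliceLeft (toDual l) (comul b)) := by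
  rw [toDual_mul]
  generalize comul (R := k) b = t
  induction t with
  | zero => simp
  | add x y hx hy => simp only [map_add, hx, hy]
  | tmul v w => simp

/-- The product of A° is dual to Δ, so left multiplication by l only translates the point b at which
one slices. -/
theorem Double.slice_inl_mul (b : A) (l : CopDual k A) (d : Double k A) :
    Double.slice b (Double.inl l * d) = Double.slice (sliceLeft (toDual l) (comul b)) d := by
  induction d using Double.induction_on with
  | add x y hx hy => simp only [map_add, mul_add, hx, hy]
  | mul m y =>
    rw [← mul_assoc, ← map_mul, Double.inl_mul_inr, Double.inl_mul_inr, Double.slice_of,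
      Double.slice_of, contract_tmul, contract_tmul, toDual_mul_apply]

theorem Double.inr_mul_inl (y : A) (l : CopDual k A) :
    Double.inr y * Double.inl l = Double.of (act (comul₃ k A y) (l ⊗ₜ 1)) := by
  rw [Double.inl_apply, Double.inr_mul_of]; rfl

theorem Double.inr_mul_inl_mul_inr (y z : A) (l : CopDual k A) :
    Double.inr y * (Double.inl l * Double.inr z) = Double.of (act (comul₃ k A y) (l ⊗ₜ z)) := by
  rw [Double.inl_mul_inr, Double.inr_mul_of]; rfl

theorem comul₃_of_isGroupLikeElem {a : A} (ha : IsGroupLikeElem k a) :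
    comul₃ k A a = a ⊗ₜ (a ⊗ₜ a) := by
  simp [comul₃, ha.comul_eq_tmul_self]

theorem antipodeInv_of_isGroupLikeElem {a : A} (ha : IsGroupLikeElem k a) :
    antipodeInv k A a = antipode k a :=
  antipode_inj k (by simp [ha.antipode_antipode])

end Slice

/-! ### The antipode of the double on its two subalgebras -/

section Antipode
variable {k A : Type*} [Field k] [Ring A] [HopfAlgebra k A]
variable [FiniteDimensional k A] [InvertibleAntipode k A]

@[simp] theorem Double.antipode_inl (l : CopDual k A) :
    HopfAlgebra.antipode k (Double.inl l) = Double.inl (HopfAlgebra.antipode k l) := by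
  have h : HopfAlgebra.antipode k (Double.inl l) = Double.antipode (Double.of (l ⊗ₜ[k] (1 : A))) := rfl
  rw [h, Double.antipode_of]; simp

@[simp] theorem Double.antipode_inr (y : A) :
    HopfAlgebra.antipode k (Double.inr y : Double k A) = Double.inr (HopfAlgebra.antipode k y) := by
  have h : HopfAlgebra.antipode k (Double.inr y : Double k A) =
    Double.antipode (Double.of ((1 : CopDual k A) ⊗ₜ[k] y)) := rfl
  rw [h, Double.antipode_of]; simp

end Antipode

/-! ### The canonical elements u, û and g -/

section Canonical
variable {k A : Type*} [Field k] [Ring A] [HopfAlgebra k A]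
variable [FiniteDimensional k A] [InvertibleAntipode k A] {ι : Type*} [Fintype ι]

/-- The canonical tensor `∑ᵢ fᵢ ⊗ eᵢ`. -/
def canonicalTensor (e : Module.Basis ι k A) : CopDual k A ⊗[k] A :=
  ∑ i, toDual.symm (e.coord i) ⊗ₜ e i

@[simp] theorem contract_canonicalTensor (e : Module.Basis ι k A) (b : A) :
    contract b (canonicalTensor e) = b := by
  simp [canonicalTensor, e.sum_repr]

/-- The canonical tensor is the identity map of A, and the antipode of A° is the transpose of S⁻¹,
so S ⊗ S turns it into S ∘ S⁻¹. -/
theorem map_antipode_canonicalTensor (e : Module.Basis ι k A) :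
    TensorProduct.map (antipode k) (antipode k) (canonicalTensor e) = canonicalTensor e := by
  refine contract_ext fun b => ?_
  have h : ∀ t : CopDual k A ⊗[k] A, contract b (TensorProduct.map (antipode k) (antipode k) t) =
      antipode k (contract (antipodeInv k A b) t) := by
    intro t
    induction t with
    | zero => simp
    | add x y hx hy => simp only [map_add, hx, hy]
    | tmul v w => simp
  rw [h]; simp

theorem canonicalU_eq (e : Module.Basis ι k A) : canonicalU e =
    Double.of (LinearMap.rTensor A (antipode k) (canonicalTensor e)) := by
  simp [canonicalU, canonicalTensor, Double.inl_mul_inr]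

theorem slice_canonicalU (e : Module.Basis ι k A) (b : A) :
    Double.slice b (canonicalU e) = antipodeInv k A b := by
  rw [canonicalU_eq, Double.slice_of]
  have h : ∀ t : CopDual k A ⊗[k] A, contract b (LinearMap.rTensor A (antipode k) t) =
      contract (antipodeInv k A b) t := by
    intro t
    induction t with
    | zero => simp
    | add x y hx hy => simp only [map_add, hx, hy]
    | tmul v w => simp
  rw [h]; simp

/-- The commutation rule gives y'' S⁻¹(S⁻¹(y''') b y') = y'' S⁻¹(y') S⁻¹(b) S⁻²(y'''), and y''
S⁻¹(y') collapses to a counit. -/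
theorem slice_inr_mul_canonicalU (e : Module.Basis ι k A) (b y : A) :
    Double.slice b (Double.inr y * canonicalU e) =
      antipodeInv k A b * antipodeInv k A (antipodeInv k A y) := by
  have h : ∀ t : A ⊗[k] (A ⊗[k] A),
      contract b (act t (LinearMap.rTensor A (antipode k) (canonicalTensor e))) =
        LinearMap.mul' k A (TensorProduct.map .id (LinearMap.mulLeft k (antipodeInv k A b) ∘ₗ
          antipodeInv k A ∘ₗ antipodeInv k A) (mulAntipodeInv t)) := by
    intro t
    induction t with
    | zero => simp
    | add x y hx hy => simp only [map_add, LinearMap.add_apply, hx, hy]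
    | tmul p t =>
    induction t with
    | zero => simp
    | add x y hx hy => simp only [map_add, LinearMap.add_apply, TensorProduct.tmul_add, hx, hy]
    | tmul q r =>
      have h1 : ∀ t : CopDual k A ⊗[k] A, contract b (act (p ⊗ₜ (q ⊗ₜ r))
          (LinearMap.rTensor A (antipode k) t)) =
            q * contract (antipodeInv k A (antipodeInv k A r * (b * p))) t := by
        intro t
        induction t with
        | zero => simp
        | add x y hx hy => simp only [map_add, mul_add, hx, hy]
        | tmul v w => simp
      rw [h1]
      simp [antipodeInv_mul, mul_assoc]
  have h2 : Double.inr y * canonicalU e = Double.of (act (comul₃ k A y)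
      (LinearMap.rTensor A (antipode k) (canonicalTensor e))) := by
    rw [canonicalU_eq, Double.inr_mul_of]; rfl
  rw [h2, Double.slice_of, h, mulAntipodeInv_comul₃]
  simp

/-- Both sides have slice S⁻¹(b) y at b. -/
theorem canonicalU_mul_inr (e : Module.Basis ι k A) (y : A) : canonicalU e * Double.inr y =
    Double.inr (antipode k (antipode k y)) * canonicalU e := by
  refine Double.slice_ext fun b => ?_
  rw [Double.slice_mul_inr, slice_canonicalU, slice_inr_mul_canonicalU]
  simp

theorem antipode_canonicalU_mul_inr (e : Module.Basis ι k A) (y : A) :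
    antipode k (canonicalU e) * Double.inr (antipode k (antipode k y)) =
      Double.inr y * antipode k (canonicalU e) := by
  have h := congr(antipode k $(canonicalU_mul_inr e (antipodeInv k A y)))
  simp only [antipode_mul_antidistrib, Double.antipode_inr, antipode_antipodeInv] at h
  exact h.symm

/-- `S(u) = ∑ᵢ eᵢ S(fᵢ)`. -/
theorem antipode_canonicalU (e : Module.Basis ι k A) : antipode k (canonicalU e) =
    LinearMap.mul' k _ (TensorProduct.comm k _ _ (TensorProduct.map
      (Double.inl.toLinearMap ∘ₗ antipode k) Double.inr.toLinearMap (canonicalTensor e))) := by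
  conv_rhs => rw [← map_antipode_canonicalTensor]
  simp [canonicalU, canonicalTensor, antipode_mul_antidistrib]

/-- Moving S(u) past S²(eⱼ) turns the product into ∑ eⱼ eᵢ S(fᵢ) fⱼ. The tensor ∑ S(fᵢ) fⱼ ⊗ eⱼ eᵢ
has slice b'' S⁻¹(b') = ε(b) 1 at b, so it is 1 ⊗ 1. -/
theorem antipode_canonicalU_mul_canonicalUHat (e : Module.Basis ι k A) :
    antipode k (canonicalU e) * canonicalUHat e = 1 := by
  have h0 : antipode k (canonicalU e) * canonicalUHat e = ∑ j, Double.inr (e j) *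
      (antipode k (canonicalU e) * Double.inl (toDual.symm (e.coord j))) := by
    simp only [canonicalUHat, Finset.mul_sum, Double.antipode_inr, ← mul_assoc,
      antipode_canonicalU_mul_inr]
  let Ξ : CopDual k A ⊗[k] A →ₗ[k] Double k A := LinearMap.mul' k _ ∘ₗ
    (TensorProduct.comm k _ _).toLinearMap ∘ₗ
      TensorProduct.map Double.inl.toLinearMap Double.inr.toLinearMap
  have h1 : ∑ j, Double.inr (e j) * (antipode k (canonicalU e) *
      Double.inl (toDual.symm (e.coord j))) = Ξ (∑ j, ∑ i,
        (antipode k (toDual.symm (e.coord i)) * toDual.symm (e.coord j)) ⊗ₜ (e j * e i)) := by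
    rw [antipode_canonicalU]
    simp [canonicalTensor, Ξ, Finset.mul_sum, Finset.sum_mul, mul_assoc]
  have h2 : ∑ j, ∑ i, (antipode k (toDual.symm (e.coord i)) * toDual.symm (e.coord j)) ⊗ₜ[k]
      (e j * e i) = (1 : CopDual k A) ⊗ₜ[k] (1 : A) := by
    refine contract_ext fun b => ?_
    have h3 : ∀ t : A ⊗[k] A, ∑ j, ∑ i, LinearMap.mul' k k (TensorProduct.map
        (toDual (antipode k (toDual.symm (e.coord i)))) (e.coord j) t) • (e j * e i) =
        LinearMap.mul' k A (TensorProduct.map .id (antipodeInv k A)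
          (TensorProduct.comm k A A t)) := by
      intro t
      induction t with
      | zero => simp
      | add x y hx hy => simp only [map_add, add_smul, Finset.sum_add_distrib, hx, hy]
      | tmul v w =>
        calc _ = (∑ j, e.repr w j • e j) * (∑ i, e.repr (antipodeInv k A v) i • e i) := by
              rw [Finset.sum_mul_sum]
              simp [smul_smul, mul_comm]
          _ = _ := by simp [e.sum_repr]
    simp only [map_sum, contract_tmul, toDual_mul, LinearEquiv.apply_symm_apply]
    rw [h3, mul_antipodeInv]
    simp [Algebra.algebraMap_eq_smul_one]
  rw [h0, h1, h2]
  simp [Ξ]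

variable {μ : Module.Dual k A} {x a : A} {α : A →ₐ[k] k}

/-- The canonical tensor is `μ(- x') ⊗ a S(x'')`. -/
theorem canonicalTensor_eq (e : Module.Basis ι k A) (hx : IsLeftCointegral k x) (hμx : μ x = 1)
    (ha : IsComodulus μ a) : canonicalTensor e =
      TensorProduct.map (toDual.symm.toLinearMap ∘ₗ LinearMap.llcomp k A A k μ ∘ₗ
        (LinearMap.mul k A).flip) (LinearMap.mulLeft k a ∘ₗ antipode k) (comul x) := by
  refine contract_ext fun b => ?_
  rw [contract_canonicalTensor]
  refine (mul_antipode_sliceLeft hx hμx ha b).symm.trans ?_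
  generalize comul (R := k) x = t
  induction t with
  | zero => simp
  | add x y hx hy => simp only [map_add, mul_add, hx, hy]
  | tmul v w => simp

/-- `S(u) = a α⁻¹ u`. -/
theorem antipode_canonicalU_eq (e : Module.Basis ι k A) (hμ : IsLeftIntegral μ)
    (hx : IsLeftCointegral k x) (hμx : μ x = 1) (hα : IsModulus x α) (ha : IsComodulus μ a) :
    antipode k (canonicalU e) = Double.inr a *
      (Double.inl (antipode k (toDual.symm α.toLinearMap)) * canonicalU e) := by
  let M : A →ₗ[k] CopDual k A := toDual.symm.toLinearMap ∘ₗ LinearMap.llcomp k A A k μ ∘ₗ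
        (LinearMap.mul k A).flip
  let W : A ⊗[k] A →ₗ[k] Double k A := LinearMap.mul' k _ ∘ₗ
    (TensorProduct.comm k _ _).toLinearMap ∘ₗ TensorProduct.map
      (Double.inl.toLinearMap ∘ₗ antipode k ∘ₗ M) (Double.inr.toLinearMap ∘ₗ antipode k)
  have h1 : antipode k (canonicalU e) = Double.inr a * W (comul x) := by
    rw [antipode_canonicalU, canonicalTensor_eq e hx hμx ha]
    generalize comul (R := k) x = t
    induction t with
    | zero => simp
    | add x y hx hy => simp only [map_add, mul_add, hx, hy]
    | tmul v w => simp [W, M, mul_assoc]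
  rw [h1]
  congr 1
  refine Double.slice_ext fun b => ?_
  -- Slicing at S(c) lets the antipodes cancel against the S⁻¹ built into the antipode of A°.
  obtain ⟨c, rfl⟩ : ∃ c, b = antipode k c := ⟨antipodeInv k A b, by simp⟩
  let Q : A ⊗[k] (A ⊗[k] A) →ₗ[k] A := antipode k ∘ₗ sliceRight μ ∘ₗ
    LinearMap.mul' k (A ⊗[k] A) ∘ₗ (TensorProduct.comm k _ _).toLinearMap ∘ₗ
      LinearMap.rTensor (A ⊗[k] A) (TensorProduct.mk k A A 1 ∘ₗ LinearMap.mulLeft k c)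
  -- For t = w ⊗ z the slice is μ(z''' c S⁻¹(z') w) S(z''). At t = Δ(x) the factor S⁻¹(z') w
  -- collapses, leaving S(x') μ(x'' c) = c' α(c''), which is also the slice of α⁻¹ u at S(c).
  have h2 : ∀ t, Double.slice (antipode k c) (W t) =
      Q (antipodeInvMul (A ⊗[k] A) (LinearMap.lTensor A (comul₃ k A) t)) := by
    intro t
    induction t with
    | zero => simp
    | add x y hx hy => simp only [map_add, hx, hy]
    | tmul w z =>
      have h3 : W (w ⊗ₜ z) = Double.inr (antipode k z) * Double.inl (antipode k (M w)) := by
        simp [W]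
      rw [h3, Double.inr_mul_inl, Double.slice_of, comul₃_antipode, LinearMap.lTensor_tmul]
      generalize comul₃ k A z = t
      induction t with
      | zero => simp
      | add x y hx hy => simp only [map_add, TensorProduct.tmul_add, LinearMap.add_apply, hx, hy]
      | tmul p t =>
      induction t with
      | zero => simp
      | add x y hx hy => simp only [map_add, TensorProduct.tmul_add, LinearMap.add_apply, hx, hy]
      | tmul q r => simp [M, Q, antipodeInv_mul, mul_assoc]
  have h4 : toDual (antipode k (toDual.symm α.toLinearMap)) ∘ₗ antipode k = α.toLinearMap := by
    ext y; simp
  rw [h2, antipodeInvMul_lTensor_comul₃_comul, Double.slice_inl_mul, slice_canonicalU,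
    comul_antipode_apply, sliceLeft_map, h4, sliceLeft_comm, antipodeInv_antipode,
    ← antipode_sliceRight_comul_mul hμ hμx hα]
  simp [Q]

theorem isGroupLikeElem_toDual_symm (α : A →ₐ[k] k) :
    IsGroupLikeElem k (toDual.symm α.toLinearMap : CopDual k A) where
  counit_eq_one := by simp
  comul_eq_tmul_self := toDual₂_ext fun a b => by
    rw [toDual₂_comul_tmul]; simp [mul_comm]

theorem Double.isGroupLikeElem_inl {l : CopDual k A} (hl : IsGroupLikeElem k l) :
    IsGroupLikeElem k (Double.inl l) where
  counit_eq_one := by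
    rw [Double.inl_apply, Double.counit_of]
    simpa using hl.counit_eq_one
  comul_eq_tmul_self := by
    rw [Double.comul_inl, hl.comul_eq_tmul_self, Algebra.TensorProduct.one_def]; simp [inl_apply]

theorem Double.isGroupLikeElem_inr {y : A} (hy : IsGroupLikeElem k y) :
    IsGroupLikeElem k (Double.inr y : Double k A) where
  counit_eq_one := by
    rw [Double.inr_apply, Double.counit_of]
    simpa using hy.counit_eq_one
  comul_eq_tmul_self := by
    rw [Double.comul_inr, hy.comul_eq_tmul_self, Algebra.TensorProduct.one_def]; simp [inr_apply]

/-- `g⁻¹ = a α⁻¹`. -/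
theorem canonicalG_mul (e : Module.Basis ι k A) (hμ : IsLeftIntegral μ)
    (hx : IsLeftCointegral k x) (hμx : μ x = 1) (hα : IsModulus x α) (ha : IsComodulus μ a) :
    Double.inr a * Double.inl (antipode k (toDual.symm α.toLinearMap)) * canonicalG e = 1 := by
  rw [canonicalG, ← mul_assoc, mul_assoc (Double.inr a),
    ← antipode_canonicalU_eq e hμ hx hμx hα ha, antipode_canonicalU_mul_canonicalUHat]

end Canonical

/-! ### Integrals and cointegrals transported by the antipode -/

section RightIntegral
variable {k A : Type*} [Field k] [Ring A] [HopfAlgebra k A] [InvertibleAntipode k A]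
variable {μ : Module.Dual k A} {x a : A} {α : A →ₐ[k] k}

/-- S reverses comultiplication, so it carries the left integral μ to the right integral μ ∘ S. -/
theorem sliceLeft_comp_antipode_comul (hμ : IsLeftIntegral μ) (y : A) :
    sliceLeft (μ ∘ₗ antipode k) (comul y) = μ (antipode k y) • (1 : A) := by
  apply antipode_inj k
  have h := hμ.sliceRight_comul (antipode k y)
  rw [comul_antipode_apply, sliceRight_map, sliceRight_comm] at h
  rw [h]; simp

theorem sliceRight_comp_antipode_comul (ha : IsComodulus μ a) (y : A) :
    sliceRight (μ ∘ₗ antipode k) (comul y) = μ (antipode k y) • antipode k a := by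
  apply antipode_inj k
  have h := ha.sliceLeft_comul (antipode k y)
  rw [comul_antipode_apply, sliceLeft_map, sliceLeft_comm] at h
  rw [h]; simp [ha.1.antipode_antipode]

theorem IsLeftCointegral.antipodeInv_mul (hx : IsLeftCointegral k x) (b : A) :
    antipodeInv k A x * b = counit (R := k) b • antipodeInv k A x := by
  apply antipode_inj k
  rw [antipode_mul_antidistrib, antipode_antipodeInv, hx, counit_antipode, map_smul,
    antipode_antipodeInv]

theorem IsModulus.mul_antipodeInv (hα : IsModulus x α) (b : A) :
    b * antipodeInv k A x = α (antipode k b) • antipodeInv k A x := by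
  apply antipode_inj k
  rw [antipode_mul_antidistrib, antipode_antipodeInv, hα, map_smul, antipode_antipodeInv]

variable [FiniteDimensional k A]

/-- α is group like in A°, hence fixed by the square of the antipode of A°. -/
theorem character_antipodeInv (α : A →ₐ[k] k) (b : A) :
    α (antipodeInv k A b) = α (antipode k b) := by
  have h := (isGroupLikeElem_toDual_symm α).antipode_antipode
  simpa using congr(toDual $h (antipode k b))

end RightIntegral

/-! ### Integrals of the double and their comodulus -/

section ProductForm
variable {k A : Type*} [Field k] [Ring A] [HopfAlgebra k A] [FiniteDimensional k A]
  [InvertibleAntipode k A]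
variable {μ : Module.Dual k A} {x a r : A} {α : A →ₐ[k] k}

/-- The linear form `l ⋅ y ↦ l(r) m(y)` on the double. -/
def Double.productForm (r : A) (m : Module.Dual k A) : Module.Dual k (Double k A) :=
  m ∘ₗ Double.slice r

@[simp] theorem Double.productForm_of (r : A) (m : Module.Dual k A) (l : CopDual k A) (y : A) :
    Double.productForm r m (Double.of (l ⊗ₜ y)) = toDual l r * m y := by
  simp [Double.productForm]

theorem doubleIntegral_eq (μ : Module.Dual k A) (x : A) :
    doubleIntegral μ x = Double.productForm x (μ ∘ₗ antipode k) := by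
  ext d
  induction d using Double.induction_on with
  | add x y hx hy => simp only [map_add, hx, hy]
  | mul l y => rw [doubleIntegral_inl_mul_inr, Double.inl_mul_inr]; simp

/-- D(A) has the tensor product coalgebra structure, so slicing by a product form splits into one
slice for each factor. -/
theorem Double.rTensor_productForm (r : A) (m : Module.Dual k A)
    (s : CopDual k A ⊗[k] CopDual k A) (t : A ⊗[k] A) :
    TensorProduct.lid k _ (LinearMap.rTensor (Double k A) (Double.productForm r m)
      (Double.of₂ (s ⊗ₜ t))) = Double.of (contract r s ⊗ₜ sliceLeft m t) := by
  induction s with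
  | zero => simp
  | add x y hx hy => simp only [map_add, TensorProduct.add_tmul, hx, hy]
  | tmul l l' =>
  induction t with
  | zero => simp
  | add x y hx hy => simp only [map_add, TensorProduct.tmul_add, hx, hy]
  | tmul y y' => simp [← TensorProduct.smul_tmul', TensorProduct.tmul_smul, smul_smul, mul_comm]

theorem Double.lTensor_productForm (r : A) (m : Module.Dual k A)
    (s : CopDual k A ⊗[k] CopDual k A) (t : A ⊗[k] A) :
    TensorProduct.rid k _ (LinearMap.lTensor (Double k A) (Double.productForm r m)
      (Double.of₂ (s ⊗ₜ t))) =
        Double.of (contract r (TensorProduct.comm k _ _ s) ⊗ₜ sliceRight m t) := by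
  induction s with
  | zero => simp
  | add x y hx hy => simp only [map_add, TensorProduct.add_tmul, hx, hy]
  | tmul l l' =>
  induction t with
  | zero => simp
  | add x y hx hy => simp only [map_add, TensorProduct.tmul_add, hx, hy]
  | tmul y y' => simp [← TensorProduct.smul_tmul', TensorProduct.tmul_smul, smul_smul, mul_comm]

theorem toDual_contract_comm (a b : A) (t : CopDual k A ⊗[k] CopDual k A) :
    toDual (contract a (TensorProduct.comm k _ _ t)) b = toDual₂ t (b ⊗ₜ a) := by
  induction t with
  | zero => simp
  | add x y hx hy => simp [hx, hy]
  | tmul x y => simp [mul_comm]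

/-- Each factor is a right integral: evaluation at x on A°, because ⟨Δ(l), x ⊗ b⟩ = l(bx) = ε(b)
l(x), and μ ∘ S on A. -/
theorem isRightIntegral_doubleIntegral (hμ : IsLeftIntegral μ) (hx : IsLeftCointegral k x) :
    IsRightIntegral (doubleIntegral μ x) := by
  intro d
  rw [doubleIntegral_eq]
  induction d using Double.induction_on with
  | add x y hx hy => simp only [map_add, add_smul, hx, hy]
  | mul l y =>
    have h : contract x (comul (R := k) l) = toDual l x • 1 := by
      refine CopDual.ext fun b => ?_
      rw [toDual_contract, toDual₂_comul_tmul, hx]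
      simp [mul_comm]
    rw [Double.inl_mul_inr, Double.comul_of, Double.rTensor_productForm, h,
      sliceLeft_comp_antipode_comul hμ, Double.one_def, Double.productForm_of]
    simp [← TensorProduct.smul_tmul', smul_smul, mul_comm]

theorem doubleIntegral_doubleCointegral (hμx : μ x = 1) :
    doubleIntegral μ x (doubleCointegral μ x) = 1 := by
  simp [doubleCointegral, doubleIntegral_inl_mul_inr, hμx]

/-- S⁻¹(x) absorbs right factors through ε, so evaluation at it is a left integral of A°; μ is one
of A. -/
theorem isLeftIntegral_productForm (hμ : IsLeftIntegral μ) (hx : IsLeftCointegral k x) :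
    IsLeftIntegral (Double.productForm (antipodeInv k A x) μ) := by
  intro d
  induction d using Double.induction_on with
  | add x y hx hy => simp only [map_add, add_smul, hx, hy]
  | mul l y =>
    have h : contract (antipodeInv k A x) (TensorProduct.comm k _ _ (comul (R := k) l)) =
        toDual l (antipodeInv k A x) • 1 := by
      refine CopDual.ext fun b => ?_
      rw [toDual_contract_comm, toDual₂_comul_tmul, hx.antipodeInv_mul]
      simp [mul_comm]
    rw [Double.inl_mul_inr, Double.comul_of, Double.lTensor_productForm, h,
      hμ.sliceRight_comul, Double.one_def, Double.productForm_of]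
    simp [← TensorProduct.smul_tmul', smul_smul, mul_comm]

/-- Moving a past l replaces l by its conjugate l(a⁻¹ · a), and a character with values in a field
is invariant under conjugation. -/
theorem inr_mul_inl_comm (ha : IsGroupLikeElem k a) :
    Double.inr a * Double.inl (antipode k (toDual.symm α.toLinearMap)) =
      Double.inl (antipode k (toDual.symm α.toLinearMap)) * Double.inr a := by
  rw [Double.inr_mul_inl, comul₃_of_isGroupLikeElem ha, act_tmul, Double.inl_mul_inr, mul_one]
  congr 2
  refine CopDual.ext fun c => ?_
  have h : α (antipode k a) * α a = 1 := by rw [← map_mul, ha.antipode_mul_cancel, map_one]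
  simp only [toDual_adj, toDual_antipode, antipodeInv_of_isGroupLikeElem ha,
    HopfDouble.antipodeInv_mul, antipodeInv_antipode, LinearEquiv.apply_symm_apply,
    AlgHom.toLinearMap_apply, map_mul]
  rw [mul_comm (α (antipode k a)), mul_assoc, h, mul_one]

/-- The A° factor contributes α⁻¹, since l(b S⁻¹(x)) = α(S(b)) l(S⁻¹(x)), and the A factor
contributes a; the two commute. -/
theorem isComodulus_productForm (hα : IsModulus x α) (ha : IsComodulus μ a) :
    IsComodulus (Double.productForm (antipodeInv k A x) μ)
      (Double.inr a * Double.inl (antipode k (toDual.symm α.toLinearMap))) := by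
  refine ⟨(Double.isGroupLikeElem_inr ha.1).mul
    (Double.isGroupLikeElem_inl (isGroupLikeElem_toDual_symm α).antipode), fun d => ?_⟩
  rw [inr_mul_inl_comm ha.1]
  induction d using Double.induction_on with
  | add x y hx hy => simp only [map_add, add_smul, hx, hy]
  | mul l y =>
    have h : contract (antipodeInv k A x) (comul (R := k) l) =
        toDual l (antipodeInv k A x) • antipode k (toDual.symm α.toLinearMap) := by
      refine CopDual.ext fun b => ?_
      rw [toDual_contract, toDual₂_comul_tmul, hα.mul_antipodeInv]
      simp [character_antipodeInv, mul_comm]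
    rw [Double.inl_mul_inr, Double.inl_mul_inr, Double.comul_of, Double.rTensor_productForm, h,
      ha.sliceLeft_comul, Double.productForm_of]
    simp [← TensorProduct.smul_tmul', TensorProduct.tmul_smul, smul_smul, mul_comm]

theorem productForm_ne_zero (hμx : μ x = 1) :
    Double.productForm (antipodeInv k A x) μ ≠ 0 := by
  intro h
  have h1 : ∀ f : Module.Dual k A, f (antipodeInv k A x) = 0 := fun f => by
    have := LinearMap.congr_fun h (Double.of (toDual.symm f ⊗ₜ x))
    simpa [hμx] using this
  have h2 : antipodeInv k A x = 0 := (Module.forall_dual_apply_eq_zero_iff k _).1 h1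
  have h3 : x = 0 := by rw [← antipode_antipodeInv k x, h2, map_zero]
  rw [h3, map_zero] at hμx
  exact zero_ne_one hμx

/-- Left integrals of the double are unique up to scalars. -/
theorem isLeftIntegral_eq_smul_productForm (hμ : IsLeftIntegral μ) (hx : IsLeftCointegral k x)
    (hμx : μ x = 1) {ν : Module.Dual k (Double k A)} (hν : IsLeftIntegral ν) :
    ∃ c : k, ν = c • Double.productForm (antipodeInv k A x) μ := by
  -- For fixed y, the form l ↦ ν(l · y) is evaluation at some n in A. Left invariance forces n b =
  -- ε(b) n, so S(n) is a left cointegral and n is a multiple of S⁻¹(x).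
  have h1 : ∀ y : A, ∃ c : k, ∀ l : CopDual k A,
      ν (Double.of (l ⊗ₜ y)) = c * toDual l (antipodeInv k A x) := by
    intro y
    let ψ : Module.Dual k (CopDual k A) :=
      ν ∘ₗ Double.of.toLinearMap ∘ₗ (TensorProduct.mk k (CopDual k A) A).flip y
    obtain ⟨n, hn⟩ : ∃ n : A, ∀ l, ψ l = toDual l n :=
      ⟨(Module.evalEquiv k A).symm (ψ ∘ₗ toDual.symm.toLinearMap), fun l => by simp⟩
    have h2 : ∀ b, n * b = counit (R := k) b • n := by
      intro b
      refine dual_ext (k := k) fun f => ?_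
      -- Applying the counit of A to the first output leg leaves ⟨Δ(f), b ⊗ n⟩ = f(nb), to be
      -- compared with ε(b) f(n).
      let F : Double k A →ₗ[k] CopDual k A := (TensorProduct.rid k _).toLinearMap ∘ₗ
        LinearMap.lTensor _ counit ∘ₗ Double.of.symm.toLinearMap
      have h3 : ∀ (l l' : CopDual k A) (t : A ⊗[k] A),
          F (TensorProduct.rid k _ (LinearMap.lTensor _ ν (Double.of₂ ((l ⊗ₜ l') ⊗ₜ t)))) =
          ν (Double.of (l' ⊗ₜ TensorProduct.lid k A (LinearMap.rTensor A counit t))) • l := by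
        intro l l' t
        induction t with
        | zero => simp
        | add x y hx hy => simp only [map_add, TensorProduct.tmul_add, add_smul, hx, hy]
        | tmul p q => simp [F, smul_smul, mul_comm]
      have h4 : ∀ s : CopDual k A ⊗[k] CopDual k A,
          toDual (F (TensorProduct.rid k _ (LinearMap.lTensor _ ν
            (Double.of₂ (s ⊗ₜ comul y))))) b = toDual₂ s (b ⊗ₜ n) := by
        intro s
        induction s with
        | zero => simp
        | add x y hx hy => simp only [map_add, TensorProduct.add_tmul, LinearMap.add_apply, hx, hy]
        | tmul l l' =>
          rw [h3, toDual₂_tmul, ← hn]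
          simp [ψ, mul_comm]
      have h5 := h4 (comul (toDual.symm f))
      rw [← Double.comul_of, hν, toDual₂_comul_tmul] at h5
      rw [LinearEquiv.apply_symm_apply] at h5
      rw [← h5]
      have h6 : ν (Double.of (toDual.symm f ⊗ₜ y)) = f n := by simpa [ψ] using hn (toDual.symm f)
      rw [h6]
      simp [F, Double.one_def, mul_comm]
    have h7 := IsLeftCointegral.eq_smul hμ hx hμx (z := antipode k n) fun b => by
      have h8 : b * antipode k n = antipode k (n * antipodeInv k A b) := by
        rw [antipode_mul_antidistrib, antipode_antipodeInv]
      rw [h8, h2, map_smul, counit_antipodeInv]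
    refine ⟨μ (antipode k n), fun l => ?_⟩
    have h9 : n = μ (antipode k n) • antipodeInv k A x := by
      rw [← map_smul, ← h7, antipodeInv_antipode]
    have h10 : ν (Double.of (l ⊗ₜ y)) = toDual l n := hn l
    rw [h10]
    conv_lhs => rw [h9]
    simp
  -- A normalised f exists because S⁻¹(x) ≠ 0; otherwise the product form would vanish.
  obtain ⟨f, hf⟩ : ∃ f : Module.Dual k A, f (antipodeInv k A x) = 1 := by
    by_contra! h
    refine productForm_ne_zero (k := k) (A := A) hμx (LinearMap.ext fun d => ?_)
    have h2 : antipodeInv k A x = 0 := (Module.forall_dual_apply_eq_zero_iff k _).1 fun f => by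
      by_contra h3
      exact h ((f (antipodeInv k A x))⁻¹ • f) (by simp [h3])
    induction d using Double.induction_on with
    | add x y hx hy => simp only [map_add, hx, hy]
    | mul l y => simp [Double.inl_mul_inr, h2]
  let m : Module.Dual k A :=
    ν ∘ₗ Double.of.toLinearMap ∘ₗ TensorProduct.mk k (CopDual k A) A (toDual.symm f)
  have hm : ∀ (l : CopDual k A) (y : A),
      ν (Double.of (l ⊗ₜ y)) = toDual l (antipodeInv k A x) * m y := by
    intro l y
    obtain ⟨c, hc⟩ := h1 y
    simp [m, hc, hf, mul_comm]
  have hmi : IsLeftIntegral m := by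
    intro y
    -- Slicing at 1 applies the counit of A°, which reduces the invariance of ν on D(A) to that of m
    -- on A.
    have h3 : ∀ (s : CopDual k A ⊗[k] CopDual k A) (t : A ⊗[k] A),
        Double.slice 1 (TensorProduct.rid k _ (LinearMap.lTensor _ ν (Double.of₂ (s ⊗ₜ t)))) =
        toDual (contract 1 s) (antipodeInv k A x) • sliceRight m t := by
      intro s t
      induction s with
      | zero => simp
      | add x y hx hy =>
        simp only [map_add, TensorProduct.add_tmul, add_smul, LinearMap.add_apply, hx, hy]
      | tmul l l' =>
      induction t with
      | zero => simp
      | add x y hx hy => simp only [map_add, TensorProduct.tmul_add, smul_add, hx, hy]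
      | tmul p q =>
        simp [hm, smul_smul]
        ring_nf
    have h4 := h3 (comul (toDual.symm f)) (comul y)
    rw [← Double.comul_of, hν, toDual_contract, toDual₂_comul_tmul, hm] at h4
    have h5 : sliceRight m (comul y) = m y • 1 := by simpa [hf, Double.one_def] using h4.symm
    exact h5
  refine ⟨m x, LinearMap.ext fun d => ?_⟩
  induction d using Double.induction_on with
  | add x y hx hy => simp only [map_add, hx, hy]
  | mul l y =>
    rw [Double.inl_mul_inr, hm, IsLeftIntegral.eq_smul hμ hx hμx hmi]
    simp [hμx]
    ring

/-- A scalar multiple of an integral keeps its comodulus, and at a point z with ν(z) ≠ 0 the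
defining equation determines the comodulus. -/
theorem isComodulus_iff (hμ : IsLeftIntegral μ) (hx : IsLeftCointegral k x) (hμx : μ x = 1)
    (hα : IsModulus x α) (ha : IsComodulus μ a) {ν : Module.Dual k (Double k A)}
    (hν : IsLeftIntegral ν) (hν0 : ν ≠ 0) (d : Double k A) : IsComodulus ν d ↔
      d = Double.inr a * Double.inl (antipode k (toDual.symm α.toLinearMap)) := by
  have h1 : IsComodulus ν
      (Double.inr a * Double.inl (antipode k (toDual.symm α.toLinearMap))) := by
    obtain ⟨c, rfl⟩ := isLeftIntegral_eq_smul_productForm hμ hx hμx hν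
    have h := isComodulus_productForm hα ha
    refine ⟨h.1, fun d => ?_⟩
    rw [LinearMap.rTensor_smul, LinearMap.smul_apply, map_smul, h.2, LinearMap.smul_apply,
      smul_assoc]
  refine ⟨fun h => ?_, fun h => h ▸ h1⟩
  obtain ⟨z, hz⟩ : ∃ z, ν z ≠ 0 := by
    by_contra! h
    exact hν0 (LinearMap.ext h)
  exact smul_right_injective _ hz ((h.2 z).symm.trans (h1.2 z))

end ProductForm

/-! ### The q-character property of μ_D -/

section QCharacter
variable {k A : Type*} [Field k] [Ring A] [HopfAlgebra k A] [FiniteDimensional k A]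
  [InvertibleAntipode k A]
variable {μ : Module.Dual k A} {x a : A} {α : A →ₐ[k] k}

/-- `μ_D(y ⋅ l ⋅ z) = l(x) α(y') μ(S(y'' z))`. -/
theorem doubleIntegral_inr_mul (hx : IsLeftCointegral k x) (hα : IsModulus x α)
    (l : CopDual k A) (y z : A) :
    doubleIntegral μ x (Double.inr y * (Double.inl l * Double.inr z)) =
      toDual l x * μ (antipode k z * antipode k (sliceLeft α.toLinearMap (comul y))) := by
  have h : ∀ t : A ⊗[k] (A ⊗[k] A), doubleIntegral μ x (Double.of (act t (l ⊗ₜ z))) =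
      toDual l x * μ (antipode k z * antipode k (sliceLeft α.toLinearMap (LinearMap.lTensor A
        ((TensorProduct.rid k A).toLinearMap ∘ₗ LinearMap.lTensor A counit) t))) := by
    intro t
    induction t with
    | zero => simp
    | add x y hx hy => simp only [map_add, LinearMap.add_apply, mul_add, hx, hy]
    | tmul p t =>
    induction t with
    | zero => simp
    | add x y hx hy =>
    simp only [map_add, LinearMap.add_apply, TensorProduct.tmul_add, mul_add, hx, hy]
    | tmul q r =>
      -- The A° factor is l(S⁻¹(r) x p): the modulus extracts α(p) on the right, and the cointegral
      -- property extracts ε(r) on the left.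
      rw [act_tmul, doubleIntegral_eq, Double.productForm_of, toDual_adj, hα p, mul_smul_comm, hx]
      simp [antipode_mul_antidistrib]
      ring
  have h1 : ((TensorProduct.rid k A).toLinearMap ∘ₗ LinearMap.lTensor A (counit (R := k))) ∘ₗ
      comul = .id := by
    rw [LinearMap.comp_assoc, lTensor_counit_comp_comul]
    ext; simp
  rw [Double.inr_mul_inl_mul_inr, h, comul₃, LinearMap.comp_apply, ← LinearMap.lTensor_comp_apply,
    h1, LinearMap.lTensor_id, LinearMap.id_apply]

/-- `μ_D(l ⋅ y ⋅ m) = l(x') m(x'' S(a)) μ(S(y))`. -/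
theorem doubleIntegral_mul_inl (hμ : IsLeftIntegral μ) (ha : IsComodulus μ a)
    (l m : CopDual k A) (y : A) :
    doubleIntegral μ x (Double.inl l * (Double.inr y * Double.inl m)) =
      LinearMap.mul' k k (TensorProduct.map (toDual l)
        (toDual m ∘ₗ LinearMap.mulRight k (antipode k a)) (comul x)) * μ (antipode k y) := by
  let Ψ : A ⊗[k] A →ₗ[k] k := LinearMap.applyₗ x ∘ₗ toDual.toLinearMap ∘ₗ
    LinearMap.mulLeft k l ∘ₗ LinearMap.applyₗ m ∘ₗ adj
  have h1 : ∀ t : A ⊗[k] (A ⊗[k] A), doubleIntegral μ x (Double.of (lam l (act t (m ⊗ₜ 1)))) =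
      Ψ (LinearMap.lTensor A (sliceLeft (μ ∘ₗ antipode k)) t) := by
    intro t
    induction t with
    | zero => simp
    | add x y hx hy => simp only [map_add, LinearMap.add_apply, hx, hy]
    | tmul p t =>
    induction t with
    | zero => simp
    | add x y hx hy => simp only [map_add, LinearMap.add_apply, TensorProduct.tmul_add, hx, hy]
    | tmul q r =>
      rw [act_tmul, lam_tmul, doubleIntegral_eq, Double.productForm_of]
      simp [Ψ, mul_comm]
  -- The right integral μ ∘ S absorbs y''' into 1; what remains is y' μ(S(y'')), which the comodulus
  -- turns into μ(S(y)) S(a).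
  have h2 : LinearMap.lTensor A (sliceLeft (μ ∘ₗ antipode k)) (comul₃ k A y) =
      μ (antipode k y) • (antipode k a ⊗ₜ[k] (1 : A)) := by
    rw [comul₃, LinearMap.comp_apply, ← LinearMap.lTensor_comp_apply, TensorProduct.smul_tmul',
      ← sliceRight_comp_antipode_comul ha]
    generalize comul (R := k) y = t
    induction t with
    | zero => simp
    | add x y hx hy => simp only [map_add, TensorProduct.add_tmul, hx, hy]
    | tmul v w => simp [sliceLeft_comp_antipode_comul hμ, TensorProduct.smul_tmul]
  have h3 : toDual (adj (antipode k a ⊗ₜ 1) m) =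
      toDual m ∘ₗ LinearMap.mulRight k (antipode k a) := by
    ext c; simp
  rw [Double.inr_mul_inl, Double.inl_mul_of, h1, h2, map_smul]
  simp [Ψ, toDual_mul, h3, mul_comm]

/-- This is x' ⊗ S²(x'') = x'' ⊗ x' a evaluated on l ⊗ S²(m)(· S(a)). Since S²(m) = m ∘ S⁻² and S²
fixes a, the squares cancel on one side and a S(a) = 1 on the other. -/
theorem comul_mul_antipode_comodulus (hμ : IsLeftIntegral μ) (hx : IsLeftCointegral k x)
    (hμx : μ x = 1) (ha : IsComodulus μ a) (l m : CopDual k A) :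
    LinearMap.mul' k k (TensorProduct.map (toDual l)
      (toDual m ∘ₗ LinearMap.mulRight k (antipode k a)) (comul x)) =
        toDual (antipode k (antipode k m) * l) x := by
  let G : A ⊗[k] A →ₗ[k] k := LinearMap.mul' k k ∘ₗ TensorProduct.map (toDual l)
    (toDual (antipode k (antipode k m)) ∘ₗ LinearMap.mulRight k (antipode k a))
  have h := congr(G $(lTensor_antipode_antipode_comul hμ hx hμx ha))
  rw [toDual_mul]
  have h1 : ∀ t : A ⊗[k] A, G (LinearMap.lTensor A (antipode k ∘ₗ antipode k) t) =
      LinearMap.mul' k k (TensorProduct.map (toDual l)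
      (toDual m ∘ₗ LinearMap.mulRight k (antipode k a)) t) := by
    intro t
    induction t with
    | zero => simp
    | add x y hx hy => simp only [map_add, hx, hy]
    | tmul v w =>
      simp [G, antipodeInv_mul, antipodeInv_of_isGroupLikeElem ha.1.antipode,
        antipodeInv_of_isGroupLikeElem ha.1, ha.1.antipode_antipode]
  have h2 : ∀ t : A ⊗[k] A, G (TensorProduct.comm k A A t * 1 ⊗ₜ a) =
      LinearMap.mul' k k (TensorProduct.map (toDual (antipode k (antipode k m))) (toDual l) t) := by
    intro t
    induction t with
    | zero => simp
    | add x y hx hy => simp only [map_add, add_mul, hx, hy]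
    | tmul v w =>
      simp [G, mul_assoc, ha.1.mul_antipode_cancel, mul_comm (toDual l w)]
  rw [← h1, h, h2]

theorem isQCharacter_doubleIntegral (hμ : IsLeftIntegral μ) (hx : IsLeftCointegral k x)
    (hμx : μ x = 1) : IsQCharacter (doubleIntegral μ x) := by
  obtain ⟨α, hα⟩ := exists_isModulus hμ hx hμx
  obtain ⟨a, ha⟩ := exists_isComodulus hμ hx hμx
  -- The identity for generators from A is the Nakayama formula with h = S²(z), for which S⁻¹(h) =
  -- S(z).
  have h1 : ∀ (z : A) (d : Double k A), doubleIntegral μ x (d * Double.inr z) =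
      doubleIntegral μ x (Double.inr (antipode k (antipode k z)) * d) := by
    intro z d
    induction d using Double.induction_on with
    | add x y hx hy => simp only [map_add, add_mul, mul_add, hx, hy]
    | mul l y =>
      rw [doubleIntegral_inr_mul hx hα, nakayama hμ hx hμx hα, mul_assoc, ← map_mul,
        doubleIntegral_inl_mul_inr, antipode_mul_antidistrib, antipodeInv_antipode]
  have h2 : ∀ (m : CopDual k A) (d : Double k A), doubleIntegral μ x (d * Double.inl m) =
      doubleIntegral μ x (Double.inl (antipode k (antipode k m)) * d) := by
    intro m d
    induction d using Double.induction_on with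
    | add x y hx hy => simp only [map_add, add_mul, mul_add, hx, hy]
    | mul l y =>
      rw [mul_assoc, doubleIntegral_mul_inl hμ ha, comul_mul_antipode_comodulus hμ hx hμx ha,
        ← mul_assoc, ← map_mul, doubleIntegral_inl_mul_inr]
  intro c d
  induction d using Double.induction_on with
  | add x y hx hy => simp only [map_add, add_mul, mul_add, hx, hy]
  | mul l y =>
    -- Since S² is multiplicative, it suffices to move first y and then l to the front.
    rw [← mul_assoc, h1, ← mul_assoc, h2]
    simp [antipode_mul_antidistrib, mul_assoc]

/-- Taking z = 1 in `doubleIntegral_inr_mul` gives l(x) α(y') μ(S(y'')) = l(x) μ(S(y)) α(S(a)), and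
α(S(a)) is inverse to α(a). -/
theorem doubleIntegral_inl_mul_inr_eq (hx : IsLeftCointegral k x)
    (hα : IsModulus x α) (ha : IsComodulus μ a) (l : CopDual k A) (y : A) :
    doubleIntegral μ x (Double.inl l * Double.inr y) =
      α a * doubleIntegral μ x (Double.inr y * Double.inl l) := by
  have h := doubleIntegral_inr_mul (μ := μ) hx hα l y 1
  have h1 : ∀ t : A ⊗[k] A, μ (antipode k (sliceLeft α.toLinearMap t)) =
      α (sliceRight (μ ∘ₗ antipode k) t) := by
    intro t
    induction t with
    | zero => simp
    | add x y hx hy => simp only [map_add, hx, hy]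
    | tmul v w => simp [mul_comm]
  have h2 : α a * α (antipode k a) = 1 := by rw [← map_mul, ha.1.mul_antipode_cancel, map_one]
  rw [map_one, mul_one, antipode_one, one_mul, h1, sliceRight_comp_antipode_comul ha, map_smul,
    smul_eq_mul] at h
  rw [h, doubleIntegral_inl_mul_inr]
  linear_combination (-toDual l x * μ (antipode k y)) * h2

end QCharacter

end HopfDouble

end

/-! ### The theorem -/

open HopfDouble
theorem mainTheorem7 {k A : Type*} [Field k] [Ring A] [HopfAlgebra k A] [FiniteDimensional k A]
    [InvertibleAntipode k A] {ι : Type*} [Fintype ι] (e : Module.Basis ι k A)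
    (μ : Module.Dual k A) (x : A) (hμ : IsLeftIntegral μ) (hx : IsLeftCointegral k x)
    (hμx : μ x = 1) :
    (IsRightIntegral (doubleIntegral μ x) ∧
      doubleIntegral μ x (doubleCointegral μ x) = 1) ∧
    (IsUnit (canonicalG e) ∧
      (∃ ν : Module.Dual k (Double k A), IsLeftIntegral ν ∧ ν ≠ 0) ∧
      ∀ ν : Module.Dual k (Double k A), IsLeftIntegral ν → ν ≠ 0 →
        ∀ a_D : Double k A, IsComodulus ν a_D ↔ a_D = Ring.inverse (canonicalG e)) ∧
    (IsQCharacter (doubleIntegral μ x) ∧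
      ∀ (α : A →ₐ[k] k) (a : A), IsModulus x α → IsComodulus μ a →
        ∀ (l : CopDual k A) (y : A),
          doubleIntegral μ x (Double.inl l * Double.inr y) =
            α a * doubleIntegral μ x (Double.inr y * Double.inl l)) := by
  obtain ⟨α, hα⟩ := exists_isModulus hμ hx hμx
  obtain ⟨a, ha⟩ := exists_isComodulus hμ hx hμx
  have hg := canonicalG_mul e hμ hx hμx hα ha
  -- The equation a α⁻¹ g = 1 is one-sided, but a α⁻¹ is group like and hence a unit, so g is its
  -- two-sided inverse. `Ring.inverse` is therefore the true inverse here and not its default value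
  -- 0.
  obtain ⟨w, hw⟩ := (isComodulus_productForm hα ha).1.isUnit
  have hgw : canonicalG e = ↑w⁻¹ := by
    rw [← hw] at hg
    rw [← w.inv_mul_cancel_left (canonicalG e), hg, mul_one]
  refine ⟨⟨isRightIntegral_doubleIntegral hμ hx, doubleIntegral_doubleCointegral hμx⟩,
    ⟨hgw ▸ w⁻¹.isUnit, ⟨_, isLeftIntegral_productForm hμ hx, productForm_ne_zero hμx⟩,
      fun ν hν hν0 d => ?_⟩, isQCharacter_doubleIntegral hμ hx hμx,
    fun α a hα ha l y => doubleIntegral_inl_mul_inr_eq hx hα ha l y⟩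
  rw [isComodulus_iff hμ hx hμx hα ha hν hν0, hgw, Ring.inverse_unit, inv_inv, hw]
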